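/- Lemma (lemma:norm_concentration). Fix constants $\sigma,\rho,\alpha>0$ and a time horizon $T$. Let $d=d_n,\ h=h_n\to\infty$ with $d/h\to\alpha$ (all objects below depend on $n$). For $\Phi,\bar\Phi\in\mathbb{R}^{h\times d}$ and $W\in\mathbb{R}^{h\times h}$ let $$\mathcal{L}(\Phi,W;\bar\Phi)=\mathbb{E}_{x_0\sim N(0,I_d)}\,\mathbb{E}_{x,x'\mid x_0}\left[-\frac{\langle W\Phi x,\bar\Phi x'\rangle}{\|W\Phi x\|_2\,\|\bar\Phi x'\|_2}\right]+\frac{\rho}{2}\left(\|\Phi\|_F^2+\|W\|_F^2\right),$$ where, given the anchor $x_0$, the views $x,x'$ are independent with law $N(x_0,\sigma^2 I_d)$, and $\bar\Phi$ is the stop-gradient copy of $\Phi$, treated as a constant in differentiation. Consider random trajectories $(\Phi(t),W(t))_{t\in[0,T]}$ in $\mathbb{R}^{h\times d}\times\mathrm{Sym}_h$ such that 1. (initialization) $\sqrt d\,\Phi(0)_{ij}\sim N(0,1)$ and $\sqrt h\,W(0)_{ij}\sim N(0,1)$ for all $i,j$, where $W(0)$ is symmetric and the entries of $\Phi(0)$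 together with the entries of $W(0)$ on and above the diagonal are independent; 2. (dynamics) with probability tending to one, on all of $[0,T]$ the matrix $W(t)$ is symmetric and $(\Phi,W)$ solves the gradient flow of $\mathcal{L}$ on $\mathbb{R}^{h\times d}\times\mathrm{Sym}_h$, that is, for all $V\in\mathbb{R}^{h\times d}$ and all symmetric $U\in\mathbb{R}^{h\times h}$, $$\langle\dot\Phi(t),V\rangle_F=-\tfrac{d}{ds}\Big|_{s=0}\mathcal{L}(\Phi(t)+sV,W(t);\Phi(t)),\qquad \langle\dot W(t),U\rangle_F=-\tfrac{d}{ds}\Big|_{s=0}\mathcal{L}(\Phi(t),W(t)+sU;\Phi(t)).$$ (In particular this holds for any solution of the unconstrained flow $\dot\Phi=-\nabla_\Phi\mathcal{L}$, $\dot W=-\nabla_W\mathcal{L}$ along which $W$ is symmetric.) Let $\Psi=W\Phi$, let $x_0$ be an anchor, and let $x,x'\sim N(x_0,\sigma^2I_d)$ be fresh views, independent of each other and of the trajectory. Then for every fixed $t\in[0,T]$, with $\Phi=\Phi(t)$ and $\Psi=\Psi(t)$, for fixed $x_0$, $$\frac{\|\Phi x\|_2^2}{h\sigma^2}=\frac{\|\Phi\|_F^2}{h}+\frac{\|\Phi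 x_0\|_2^2}{h\sigma^2}+o_{\mathbb{P}}(1),\qquad \frac{\|\Psi x\|_2^2}{h^2\sigma^2}=\frac{\|\Psi\|_F^2}{h^2}+\frac{\|\Psi x_0\|_2^2}{h^2\sigma^2}+o_{\mathbb{P}}(1),$$ and the same two relations hold with $x'$ in place of $x$. Here "for fixed $x_0$" means both of the following: (a) if $x_0\sim N(0,I_d)$ is drawn independently of the trajectory, then for every $\varepsilon>0$ the conditional probability given $x_0$ that the error term is at least $\varepsilon$ in absolute value tends to $0$ in probability; (b) for every deterministic sequence of anchors with $\|x_0\|_2^2=O(d)$, the error term tends to $0$ in probability. -/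

import Mathlib

open MeasureTheory ProbabilityTheory Filter Topology Set

noncomputable section

namespace SimSiam

/-- Column vectors with the Euclidean norm. -/
abbrev Vec (n : ℕ) : Type := EuclideanSpace ℝ (Fin n)

/-- Real matrices. -/
abbrev Mat (m n : ℕ) : Type := Matrix (Fin m) (Fin n) ℝ

/-- The matrix-vector product, valued in Euclidean space. -/
def act {m n : ℕ} (A : Mat m n) (x : Vec n) : Vec m :=
  WithLp.toLp 2 (A.mulVec x.ofLp)

/-- The Frobenius inner product. -/
def frobInner {m n : ℕ} (A B : Mat m n) : ℝ := ∑ i, ∑ j, A i j * B i j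

/-- The squared Frobenius norm. -/
def frobSq {m n : ℕ} (A : Mat m n) : ℝ := frobInner A A

/-- The input distribution `N(0, I_d)`, the law of the anchor `x₀`. -/
def inputLaw (d : ℕ) : Measure (Vec d) := stdGaussian (Vec d)

/-- The augmentation distribution `N(x₀, σ² I_d)`, the law of a view given the anchor. -/
def augLaw {d : ℕ} (σ : ℝ) (x₀ : Vec d) : Measure (Vec d) :=
  multivariateGaussian x₀ (σ ^ 2 • (1 : Matrix (Fin d) (Fin d) ℝ))

/-- The cosine loss. The target branch, which sits under the stop-gradient operator, uses its own
copy `Φt` of the representation net; it is set equal to `Φ` after differentiation. -/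
def cosLoss {h d : ℕ} (σ : ℝ) (Φ : Mat h d) (W : Mat h h) (Φt : Mat h d) : ℝ :=
  ∫ x₀, ∫ x, ∫ x',
    -(inner ℝ (act W (act Φ x)) (act Φt x') / (‖act W (act Φ x)‖ * ‖act Φt x'‖))
    ∂(augLaw σ x₀) ∂(augLaw σ x₀) ∂(inputLaw d)

/-- The cosine loss plus the weight decay `(ρ/2)(‖Φ‖_F² + ‖W‖_F²)`. -/
def objective {h d : ℕ} (σ ρ : ℝ) (Φ : Mat h d) (W : Mat h h) (Φt : Mat h d) : ℝ :=
  cosLoss σ Φ W Φt + ρ / 2 * (frobSq Φ + frobSq W)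

/-- `t ↦ A t` has (entrywise) derivative `A'` at the time `t` of the interval `[0, T]`. -/
def HasVelocity {m n : ℕ} (T : ℝ) (A : ℝ → Mat m n) (A' : Mat m n) (t : ℝ) : Prop :=
  ∀ i j, HasDerivWithinAt (fun s => A s i j) (A' i j) (Icc 0 T) t

/-- `(Φ, W)` solves, on `[0, T]`, the gradient flow of the regularized cosine loss on
`ℝ^{h×d} × Sym_h`: `W` stays symmetric, and the velocities are minus the gradients, the gradient
being characterized by the directional derivatives `⟨∇ F, V⟩_F = dF[V]` in all directions `V` of
the parameter space. For `W` these are the symmetric `V`, so every solution of the unconstrained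
equations `Φ' = -∇_Φ F`, `W' = -∇_W F` along which `W` is symmetric is in particular a solution
in this sense. -/
structure IsSymmetricGradientFlow {h d : ℕ} (σ ρ T : ℝ)
    (Φ : ℝ → Mat h d) (W : ℝ → Mat h h) : Prop where
  symm : ∀ t ∈ Icc 0 T, (W t).IsSymm
  flow_rep : ∀ t ∈ Icc 0 T, ∃ Φ' : Mat h d, HasVelocity T Φ Φ' t ∧
    ∀ V : Mat h d, HasDerivAt (fun s : ℝ => objective σ ρ (Φ t + s • V) (W t) (Φ t))
      (-(frobInner Φ' V)) 0
  flow_proj : ∀ t ∈ Icc 0 T, ∃ W' : Mat h h, HasVelocity T W W' t ∧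
    ∀ V : Mat h h, V.IsSymm →
      HasDerivAt (fun s : ℝ => objective σ ρ (Φ t) (W t + s • V) (Φ t))
        (-(frobInner W' V)) 0

/-- Gaussian initialization with a symmetric projection head: `√d Φ(0)_{ij} ∼ N(0,1)` and
`√h W(0)_{ij} ∼ N(0,1)` for all indices, where `W(0)` is symmetric and the entries of `Φ(0)` and
the entries of `W(0)` on and above the diagonal are jointly independent. -/
structure IsGaussianInit {h d : ℕ} {Ω : Type*} [MeasurableSpace Ω] (μ : Measure Ω)
    (Φ₀ : Ω → Mat h d) (W₀ : Ω → Mat h h) : Prop where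
  law_rep : ∀ i j, HasLaw (fun ω => √(d : ℝ) * Φ₀ ω i j) (gaussianReal 0 1) μ
  law_proj : ∀ i j, HasLaw (fun ω => √(h : ℝ) * W₀ ω i j) (gaussianReal 0 1) μ
  symm : ∀ᵐ ω ∂μ, (W₀ ω).IsSymm
  indep : iIndepFun (fun (k : (Fin h × Fin d) ⊕ {p : Fin h × Fin h // p.1 ≤ p.2}) (ω : Ω) =>
    Sum.elim (fun p => Φ₀ ω p.1 p.2) (fun p => W₀ ω p.1.1 p.1.2) k) μ

/-- The joint law, for a fixed anchor `x₀`, of the training randomness (law `μ`) and of two fresh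
views `x, x' ∼ N(x₀, σ² I)`, all independent. -/
def sampleLaw {Ω : Type*} [MeasurableSpace Ω] {d : ℕ} (μ : Measure Ω) (σ : ℝ) (x₀ : Vec d) :
    Measure (Ω × (Vec d × Vec d)) :=
  μ.prod ((augLaw σ x₀).prod (augLaw σ x₀))

/-- `X n = o_P(1)`: convergence to zero in probability, on possibly varying spaces. -/
def LittleOP {S : ℕ → Type*} [∀ n, MeasurableSpace (S n)] (P : ∀ n, Measure (S n))
    (X : ∀ n, S n → ℝ) : Prop :=
  ∀ ε : ℝ, 0 < ε → Tendsto (fun n => P n {s | ε ≤ |X n s|}) atTop (𝓝 0)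

/-- `X n = o_P(1)` for fixed anchors, where `X n` depends on the anchor `x₀`, the training
randomness and the two views. This asserts both that
* for anchors drawn from `N(0, I)`, the conditional probability given the anchor that `|X n|`
  exceeds `ε` tends to zero in probability with respect to the anchor (equivalently, `X n = o_P(1)`
  jointly);
* for every deterministic sequence of anchors with `‖x₀‖² = O(d)`, the typical size under
  `N(0, I)`, `X n = o_P(1)`. -/
def LittleOPFixedAnchor {d : ℕ → ℕ} {Ω : ℕ → Type*} [∀ n, MeasurableSpace (Ω n)]
    (μ : ∀ n, Measure (Ω n)) (σ : ℝ)
    (X : ∀ n, Vec (d n) → Ω n × (Vec (d n) × Vec (d n)) → ℝ) : Prop :=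
  (∀ ε : ℝ, 0 < ε → LittleOP (fun n => inputLaw (d n))
    (fun n x₀ => (sampleLaw (μ n) σ x₀).real {p | ε ≤ |X n x₀ p|})) ∧
  (∀ x₀ : ∀ n, Vec (d n), (∃ C : ℝ, ∀ n, ‖x₀ n‖ ^ 2 ≤ C * (d n : ℝ)) →
    LittleOP (fun n => sampleLaw (μ n) σ (x₀ n)) (fun n => X n (x₀ n)))

/-- The deviation
`‖A x‖² / (s σ²) - (‖A‖_F² / s + ‖A x₀‖² / (s σ²))`. -/
def normDeviation {h d : ℕ} (σ s : ℝ) (A : Mat h d) (x₀ x : Vec d) : ℝ :=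
  ‖act A x‖ ^ 2 / (s * σ ^ 2) - (frobSq A / s + ‖act A x₀‖ ^ 2 / (s * σ ^ 2))

end SimSiam

end

/-! Write a view as x = x₀ + σg with g standard Gaussian. Expanding the square leaves as error a
centred quadratic form (‖Ag‖² - ‖A‖_F²)/s and a linear form 2⟪AᵀAx₀, g⟫/(sσ), where A is Φ or Ψ and
s is h or h². If ‖A‖ ≤ K in spectral norm, their variances are of order K⁴d/s² and K⁴‖x₀‖²/s², so
Chebyshev suffices (`augLaw_normDeviation_ge_le`). Everything reduces to showing that the spectral
norms of Φ(t) and W(t) stay bounded with probability tending to one.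

This holds at time 0 for Gaussian matrices. To propagate it, multiply the nets by the integrating
factor exp(ρt), which absorbs the weight decay; the rescaled nets then move only by the cosine
gradient. The cosine is insensitive to scale, so replacing P = WΦ by P + sD changes it by at most
2|s|‖Dx‖/‖Px‖. By Cauchy-Schwarz in the form of a weighted AM-GM, the squared derivative is at most
a constant times ‖D‖_F² · E‖Px‖⁻². The inverse moment is at most 1/(σ²(‖P‖_F² - 2‖P‖²)) once the
stable rank ‖P‖_F²/‖P‖² exceeds 2 (`lintegral_inv_normSq_le`). Since ‖P(0)‖_F² ≥ h/8 with high
probability, the velocity in Frobenius norm is O(h^(-1/2)), and a barrier argument keeps the total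
displacement below one on [0, T] (`IsSymmetricGradientFlow.norm_actL_le`). The spectral norms thus
grow by at most one.

The initial estimates combine nets and sub-Gaussian tails for the spectral norms with Chebyshev,
conditionally on W(0), for ‖W(0)Φ(0)‖_F² (`prod_not_wellConditioned_le`). -/

open scoped RealInnerProductSpace

namespace SimSiam

/-! ### Moments and concentration of Gaussian quadratic and linear forms -/

section GaussianQuadraticForms

variable {E F : Type*} [NormedAddCommGroup E] [InnerProductSpace ℝ E] [FiniteDimensional ℝ E]
  [NormedAddCommGroup F] [InnerProductSpace ℝ F] [FiniteDimensional ℝ F]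

/-- Singular value decomposition of `A`, on the level of the quadratic form `‖A x‖²`. -/
theorem exists_orthonormalBasis_normSq_eq {ι : Type*} [Fintype ι] (A : E →L[ℝ] F)
    (e : OrthonormalBasis ι ℝ E) :
    ∃ (b : OrthonormalBasis (Fin (Module.finrank ℝ E)) ℝ E) (l : Fin (Module.finrank ℝ E) → ℝ),
      (∀ i, 0 ≤ l i) ∧ (∀ i, l i ≤ ‖A‖ ^ 2) ∧ (∀ x, ‖A x‖ ^ 2 = ∑ i, l i * ⟪b i, x⟫ ^ 2) ∧
      ∑ i, l i = ∑ j, ‖A (e j)‖ ^ 2 := by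
  classical
  let B : E →ₗ[ℝ] E := (LinearMap.adjoint (A : E →ₗ[ℝ] F)) ∘ₗ (A : E →ₗ[ℝ] F)
  have hB : B.IsSymmetric := by
    intro x y
    simp [B, LinearMap.adjoint_inner_left, LinearMap.adjoint_inner_right]
  have hBq : ∀ x y, ⟪x, B y⟫ = ⟪A x, A y⟫ := fun x y => by
    simp [B, LinearMap.adjoint_inner_right]
  let b := hB.eigenvectorBasis rfl
  let l := hB.eigenvalues rfl
  have hBb : ∀ i, B (b i) = l i • b i := fun i => by
    simp [b, l]
  have hl : ∀ i, l i = ‖A (b i)‖ ^ 2 := fun i => by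
    rw [← real_inner_self_eq_norm_sq, ← hBq, hBb, inner_smul_right, real_inner_self_eq_norm_sq,
      b.norm_eq_one]
    simp
  refine ⟨b, l, fun i => by rw [hl]; positivity, fun i => ?_, fun x => ?_, ?_⟩
  · rw [hl]
    have := A.le_opNorm (b i)
    rw [b.norm_eq_one, mul_one] at this
    gcongr
  · rw [← real_inner_self_eq_norm_sq, ← hBq, ← b.sum_inner_mul_inner]
    refine Finset.sum_congr rfl fun i _ => ?_
    rw [← hB, hBb, inner_smul_left, real_inner_comm x]
    simp; ring
  · have h1 := hB.trace_eq_sum_eigenvalues (n := Module.finrank ℝ E) rfl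
    rw [LinearMap.trace_eq_sum_inner B e] at h1
    simp only [hBq, real_inner_self_eq_norm_sq] at h1
    simpa [l] using h1.symm

variable [MeasurableSpace E] [BorelSpace E]

/-- The coordinates of a standard Gaussian vector in any orthonormal basis are i.i.d. -/
theorem map_inner_stdGaussian {ι : Type*} [Fintype ι] (b : OrthonormalBasis ι ℝ E) :
    (stdGaussian E).map (fun x i => ⟪b i, x⟫) = Measure.pi fun _ : ι => gaussianReal 0 1 := by
  classical
  rw [stdGaussian_eq_map_pi_orthonormalBasis b, Measure.map_map (by fun_prop) (by fun_prop)]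
  convert Measure.map_id
  ext x i
  simp [inner_sum, inner_smul_right, orthonormal_iff_ite.mp b.orthonormal]

/-- The variance of the square of a standard Gaussian variable. -/
noncomputable def varSq : ℝ := Var[fun x : ℝ => x ^ 2; gaussianReal 0 1]

theorem varSq_nonneg : 0 ≤ varSq := variance_nonneg _ _

theorem integral_sq_gaussianReal : ∫ x : ℝ, x ^ 2 ∂(gaussianReal 0 1) = 1 := by
  have h := variance_fun_id_gaussianReal (μ := 0) (v := 1)
  rw [variance_eq_integral (by fun_prop)] at h
  simpa using h

theorem memLp_sq_gaussianReal : MemLp (fun x : ℝ => x ^ 2) 2 (gaussianReal 0 1) := by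
  have h := memLp_id_gaussianReal (μ := 0) (v := 1) 4
  refine (memLp_two_iff_integrable_sq (by fun_prop)).2 ?_
  have := h.integrable_norm_pow (p := 4) (by norm_num)
  refine this.congr (ae_of_all _ fun x => ?_)
  simp only [id, Real.norm_eq_abs]
  rw [Even.pow_abs (by decide)]
  ring

theorem integral_and_variance_weighted_sum_sq {ι : Type*} [Fintype ι] (l : ι → ℝ) :
    MemLp (fun x : ι → ℝ => ∑ i, l i * x i ^ 2) 2 (Measure.pi fun _ => gaussianReal 0 1) ∧
    ∫ x : ι → ℝ, ∑ i, l i * x i ^ 2 ∂(Measure.pi fun _ => gaussianReal 0 1) = ∑ i, l i ∧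
    Var[fun x : ι → ℝ => ∑ i, l i * x i ^ 2; Measure.pi fun _ => gaussianReal 0 1]
      = ∑ i, l i ^ 2 * varSq := by
  have hm : ∀ i, MemLp (fun x : ℝ => l i * x ^ 2) 2 (gaussianReal 0 1) := fun i =>
    memLp_sq_gaussianReal.const_mul _
  have hmp : ∀ i, MemLp (fun x : ι → ℝ => l i * x i ^ 2) 2
      (Measure.pi fun _ => gaussianReal 0 1) := fun i =>
    (hm i).comp_measurePreserving (measurePreserving_eval (fun _ : ι => gaussianReal 0 1) i)
  refine ⟨memLp_finsetSum _ fun i _ => hmp i, ?_, ?_⟩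
  · rw [integral_finsetSum _ fun i _ => (hmp i).integrable (by norm_num)]
    refine Finset.sum_congr rfl fun i _ => ?_
    have := integral_comp_eval (μ := fun _ : ι => gaussianReal 0 1) (i := i)
      (f := fun x : ℝ => l i * x ^ 2) (by fun_prop)
    rw [this, integral_const_mul, integral_sq_gaussianReal, mul_one]
  · have := variance_sum_pi (μ := fun _ : ι => gaussianReal 0 1)
      (X := fun i x => l i * x ^ 2) hm
    have h2 : (∑ i, fun ω : ι → ℝ => l i * ω i ^ 2) = fun x => ∑ i, l i * x i ^ 2 := by
      ext x; simp
    rw [h2] at this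
    rw [this]
    refine Finset.sum_congr rfl fun i _ => ?_
    rw [variance_const_mul, varSq]

/-- Chebyshev's inequality for weighted chi-square variables. -/
theorem pi_weighted_sum_sq_deviation_le {ι : Type*} [Fintype ι] (l : ι → ℝ) {ε : ℝ} (hε : 0 < ε) :
    (Measure.pi fun _ : ι => gaussianReal 0 1)
      {x | ε ≤ |∑ i, l i * x i ^ 2 - ∑ i, l i|} ≤
      ENNReal.ofReal ((∑ i, l i ^ 2 * varSq) / ε ^ 2) := by
  obtain ⟨h1, h2, h3⟩ := integral_and_variance_weighted_sum_sq l
  have := meas_ge_le_variance_div_sq h1 hε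
  rwa [h2, h3] at this

/-- Concentration of `‖A g‖²` around its mean, the squared Hilbert-Schmidt norm. -/
theorem stdGaussian_normSq_deviation_le {ι : Type*} [Fintype ι] (A : E →L[ℝ] F)
    (e : OrthonormalBasis ι ℝ E) {ε : ℝ} (hε : 0 < ε) :
    stdGaussian E {x | ε ≤ |‖A x‖ ^ 2 - ∑ j, ‖A (e j)‖ ^ 2|} ≤
      ENNReal.ofReal (varSq * ‖A‖ ^ 2 * (∑ j, ‖A (e j)‖ ^ 2) / ε ^ 2) := by
  obtain ⟨b, l, hl0, hl1, hA, hsum⟩ := exists_orthonormalBasis_normSq_eq A e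
  have hmeas : MeasurableSet {x : Fin (Module.finrank ℝ E) → ℝ |
      ε ≤ |∑ i, l i * x i ^ 2 - ∑ i, l i|} :=
    measurableSet_le measurable_const (by fun_prop)
  have h := pi_weighted_sum_sq_deviation_le l hε
  rw [← map_inner_stdGaussian b, Measure.map_apply (by fun_prop) hmeas] at h
  simp only [preimage_ofPred_eq] at h
  rw [← hsum]
  simp_rw [hA]
  refine h.trans (ENNReal.ofReal_le_ofReal ?_)
  gcongr
  rw [Finset.mul_sum]
  refine Finset.sum_le_sum fun i _ => ?_
  have := mul_le_mul_of_nonneg_right (hl1 i) (hl0 i)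
  have h0 := varSq_nonneg
  nlinarith

theorem integral_inner_stdGaussian (v : E) : ∫ x, ⟪v, x⟫ ∂(stdGaussian E) = 0 :=
  integral_strongDual_stdGaussian (innerSL ℝ v)

theorem variance_inner_stdGaussian (v : E) : Var[fun x => ⟪v, x⟫; stdGaussian E] = ‖v‖ ^ 2 := by
  have := variance_dual_stdGaussian (innerSL ℝ v)
  rw [innerSL_apply_norm] at this
  exact this

theorem memLp_inner_stdGaussian (v : E) : MemLp (fun x => ⟪v, x⟫) 2 (stdGaussian E) :=
  IsGaussian.memLp_dual (stdGaussian E) (innerSL ℝ v) 2 (by norm_num)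

theorem stdGaussian_abs_inner_ge_le (v : E) {ε : ℝ} (hε : 0 < ε) :
    stdGaussian E {x | ε ≤ |⟪v, x⟫|} ≤ ENNReal.ofReal (‖v‖ ^ 2 / ε ^ 2) := by
  have := meas_ge_le_variance_div_sq (memLp_inner_stdGaussian v) hε
  simpa [integral_inner_stdGaussian, variance_inner_stdGaussian] using this

theorem integrable_sq_inner_stdGaussian (v : E) :
    Integrable (fun x => ⟪v, x⟫ ^ 2) (stdGaussian E) :=
  (memLp_inner_stdGaussian v).integrable_sq

theorem integral_sq_inner_stdGaussian (v : E) :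
    ∫ x, ⟪v, x⟫ ^ 2 ∂(stdGaussian E) = ‖v‖ ^ 2 := by
  have h := variance_inner_stdGaussian v
  rw [variance_eq_integral (memLp_inner_stdGaussian v).aemeasurable] at h
  simpa [integral_inner_stdGaussian] using h

/-- The second moment of `A g` is the squared Hilbert-Schmidt norm. -/
theorem lintegral_normSq_stdGaussian {ι : Type*} [Fintype ι] (A : E →L[ℝ] F)
    (e : OrthonormalBasis ι ℝ E) :
    ∫⁻ x, ENNReal.ofReal (‖A x‖ ^ 2) ∂(stdGaussian E) =
      ENNReal.ofReal (∑ j, ‖A (e j)‖ ^ 2) := by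
  obtain ⟨b, l, hl0, hl1, hA, hsum⟩ := exists_orthonormalBasis_normSq_eq A e
  rw [← hsum]
  simp_rw [hA]
  rw [← ofReal_integral_eq_lintegral_ofReal]
  · rw [integral_finsetSum _ fun i _ => (integrable_sq_inner_stdGaussian _).const_mul _]
    simp [integral_const_mul, integral_sq_inner_stdGaussian]
  · exact integrable_finsetSum _ fun i _ => (integrable_sq_inner_stdGaussian _).const_mul _
  · exact ae_of_all _ fun x => Finset.sum_nonneg fun i _ => mul_nonneg (hl0 i) (sq_nonneg _)

end GaussianQuadraticForms

/-! ### Inverse second moments via Laplace transforms -/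

section InverseMoments

/-- Completing the square against the Gaussian density leaves the factor exp(-s a²/(2β)) ≤ 1.
Dropping it gives the value for a = 0, which is why the later bounds are uniform in the anchor. -/
theorem integral_exp_neg_mul_sq_gaussianReal_le (a σ : ℝ) {s : ℝ} (hs : 0 ≤ s) :
    ∫ x, Real.exp (-(s * (a + σ * x) ^ 2)) ∂(gaussianReal 0 1) ≤
      (1 + 2 * s * σ ^ 2) ^ (-(1 / 2) : ℝ) := by
  set β : ℝ := s * σ ^ 2 + 1 / 2 with hβ
  have hβ0 : 0 < β := by positivity
  set c : ℝ := s * a * σ / β with hc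
  have hgi : Integrable (fun x : ℝ => Real.exp (-β * (x + c) ^ 2)) :=
    (integrable_exp_neg_mul_sq hβ0).comp_add_right c
  have hg : ∫ x : ℝ, Real.exp (-β * (x + c) ^ 2) = √(Real.pi / β) := by
    rw [integral_add_right_eq_self (fun x : ℝ => Real.exp (-β * x ^ 2)) c, integral_gaussian]
  rw [integral_gaussianReal_eq_integral_smul one_ne_zero]
  have hle : ∀ x : ℝ, gaussianPDFReal 0 1 x • Real.exp (-(s * (a + σ * x) ^ 2)) ≤
      (√(2 * Real.pi))⁻¹ * Real.exp (-β * (x + c) ^ 2) := by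
    intro x
    rw [gaussianPDFReal_def, smul_eq_mul]
    simp only [NNReal.coe_one, mul_one, sub_zero]
    rw [mul_assoc, ← Real.exp_add]
    gcongr
    have h1 : -x ^ 2 / 2 + -(s * (a + σ * x) ^ 2) =
        -β * (x + c) ^ 2 - s * a ^ 2 / (2 * β) := by
      rw [hc]; field_simp; rw [hβ]; ring
    rw [h1]
    have : 0 ≤ s * a ^ 2 / (2 * β) := by positivity
    linarith
  have hint : Integrable (fun x : ℝ => gaussianPDFReal 0 1 x • Real.exp (-(s * (a + σ * x) ^ 2))) := by
    refine (hgi.const_mul (√(2 * Real.pi))⁻¹).mono' ?_ (ae_of_all _ fun x => ?_)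
    · exact ((measurable_gaussianPDFReal 0 1).smul (by fun_prop)).aestronglyMeasurable
    · rw [Real.norm_of_nonneg]
      · exact hle x
      · exact mul_nonneg (gaussianPDFReal_nonneg _ _ _) (Real.exp_nonneg _)
  refine (integral_mono hint (hgi.const_mul _) hle).trans ?_
  rw [integral_const_mul, hg, Real.rpow_neg (by positivity), ← Real.sqrt_eq_rpow,
    Real.sqrt_div Real.pi_pos.le, Real.sqrt_mul (by norm_num)]
  have h2 : (1 : ℝ) + 2 * s * σ ^ 2 = 2 * β := by rw [hβ]; ring
  rw [h2, Real.sqrt_mul (by norm_num)]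
  apply le_of_eq
  have : 0 < √Real.pi := Real.sqrt_pos.2 Real.pi_pos
  have : 0 < √β := Real.sqrt_pos.2 hβ0
  field_simp

/-- Bernoulli's inequality with exponent l/Λ in [0, 1]. It replaces the different eigenvalues by the
common base 1 + sΛ, so that in a product only the sum of the exponents, half the ratio of trace to
Λ, remains. -/
theorem rpow_neg_half_le {s Λ l : ℝ} (hs : 0 ≤ s) (hl : 0 ≤ l) (hΛ : 0 < Λ) (hlΛ : l ≤ Λ) :
    (1 + s * l) ^ (-(1 / 2) : ℝ) ≤ (1 + s * Λ) ^ (-(l / (2 * Λ)) : ℝ) := by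
  have h := rpow_one_add_le_one_add_mul_self (s := s * Λ) (p := l / Λ)
    (by nlinarith [mul_nonneg hs hΛ.le]) (by positivity) ((div_le_one hΛ).2 hlΛ)
  have h1 : l / Λ * (s * Λ) = s * l := by field_simp
  rw [h1] at h
  have h2 : (1 + s * Λ) ^ (-(l / (2 * Λ)) : ℝ) = ((1 + s * Λ) ^ (l / Λ)) ^ (-(1 / 2) : ℝ) := by
    rw [← Real.rpow_mul (by positivity)]
    congr 1; field_simp
  rw [h2]
  exact Real.rpow_le_rpow_of_nonpos (by positivity) h (by norm_num)

theorem lintegral_exp_neg_weighted_sum_sq_le {ι : Type*} [Fintype ι] (l a : ι → ℝ) (σ : ℝ)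
    {Λ s : ℝ} (hs : 0 ≤ s) (hl : ∀ i, 0 ≤ l i) (hΛ : 0 < Λ) (hlΛ : ∀ i, l i ≤ Λ) :
    ∫⁻ x : ι → ℝ, ENNReal.ofReal (Real.exp (-(s * ∑ i, l i * (a i + σ * x i) ^ 2)))
      ∂(Measure.pi fun _ => gaussianReal 0 1) ≤
      ENNReal.ofReal ((1 + 2 * σ ^ 2 * Λ * s) ^ (-((∑ i, l i) / (2 * Λ)) : ℝ)) := by
  have hprod : ∀ x : ι → ℝ, Real.exp (-(s * ∑ i, l i * (a i + σ * x i) ^ 2)) =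
      ∏ i, Real.exp (-(s * l i * (a i + σ * x i) ^ 2)) := by
    intro x
    rw [← Real.exp_sum, Finset.mul_sum, ← Finset.sum_neg_distrib]
    congr 1
    exact Finset.sum_congr rfl fun i _ => by ring
  rw [← ofReal_integral_eq_lintegral_ofReal]
  · apply ENNReal.ofReal_le_ofReal
    simp_rw [hprod]
    rw [integral_fintype_prod_eq_prod
      (f := fun i (y : ℝ) => Real.exp (-(s * l i * (a i + σ * y) ^ 2)))]
    have h1 : ∀ i, ∫ y, Real.exp (-(s * l i * (a i + σ * y) ^ 2)) ∂(gaussianReal 0 1) ≤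
        (1 + 2 * σ ^ 2 * Λ * s) ^ (-(l i / (2 * Λ)) : ℝ) := by
      intro i
      refine (integral_exp_neg_mul_sq_gaussianReal_le (a i) σ (mul_nonneg hs (hl i))).trans ?_
      have := rpow_neg_half_le (s := 2 * s * σ ^ 2) (by positivity) (hl i) hΛ (hlΛ i)
      rw [show 1 + 2 * (s * l i) * σ ^ 2 = 1 + 2 * s * σ ^ 2 * l i by ring,
        show 1 + 2 * σ ^ 2 * Λ * s = 1 + 2 * s * σ ^ 2 * Λ by ring]
      exact this
    refine (Finset.prod_le_prod (fun i _ => integral_nonneg fun y => Real.exp_nonneg _)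
      fun i _ => h1 i).trans (le_of_eq ?_)
    rw [← Real.rpow_sum_of_pos (by positivity), Finset.sum_neg_distrib, Finset.sum_div]
  · refine (integrable_const (1 : ℝ)).mono'
      (Measurable.aestronglyMeasurable (by fun_prop)) (ae_of_all _ fun x => ?_)
    rw [Real.norm_of_nonneg (Real.exp_nonneg _)]
    apply Real.exp_le_one_iff.2
    have := Finset.sum_nonneg fun i (_ : i ∈ Finset.univ) =>
      mul_nonneg (hl i) (sq_nonneg (a i + σ * x i))
    nlinarith [mul_nonneg hs this]
  · exact ae_of_all _ fun x => Real.exp_nonneg _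

/-- Turns an inverse moment into an integral of Laplace transforms. With values in `ENNReal` the
case q = 0 reads ∞ = ∞, so no almost sure nonvanishing has to be proved. -/
theorem lintegral_exp_neg_mul_Ioi {q : ℝ} (hq : 0 ≤ q) :
    ∫⁻ s in Ioi (0 : ℝ), ENNReal.ofReal (Real.exp (-(s * q))) = (ENNReal.ofReal q)⁻¹ := by
  rcases hq.eq_or_lt with rfl | hq
  · simp
  · have h1 := integrableOn_exp_mul_Ioi (a := -q) (by linarith) 0
    have h2 := integral_exp_mul_Ioi (a := -q) (by linarith) 0
    rw [← ENNReal.ofReal_inv_of_pos hq]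
    have h3 : ∀ s : ℝ, -(s * q) = -q * s := fun s => by ring
    simp_rw [h3]
    rw [← ofReal_integral_eq_lintegral_ofReal h1 (ae_of_all _ fun x => Real.exp_nonneg _), h2]
    congr 1
    simp [neg_div]

theorem lintegral_one_add_mul_rpow_neg {c p : ℝ} (hc : 0 < c) (hp : 1 < p) :
    ∫⁻ s in Ioi (0 : ℝ), ENNReal.ofReal ((1 + c * s) ^ (-p)) =
      ENNReal.ofReal (1 / (c * (p - 1))) := by
  have hp' : 0 < p - 1 := by linarith
  have hderiv : ∀ x ∈ Ici (0 : ℝ), HasDerivAt (fun s : ℝ => -(1 / (c * (p - 1))) * (1 + c * s) ^ (1 - p))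
      ((1 + c * x) ^ (-p)) x := by
    intro x hx
    have hx0 : (0 : ℝ) < 1 + c * x := by
      have : (0 : ℝ) ≤ x := hx
      positivity
    have h1 : HasDerivAt (fun s : ℝ => 1 + c * s) c x := by
      simpa using ((hasDerivAt_id x).const_mul c).const_add 1
    have h2 := (h1.rpow_const (p := 1 - p) (Or.inl hx0.ne')).const_mul (-(1 / (c * (p - 1))))
    refine h2.congr_deriv ?_
    rw [show 1 - p - 1 = -p by ring]
    field_simp
    ring
  have hpos : ∀ x ∈ Ioi (0 : ℝ), 0 ≤ (1 + c * x) ^ (-p) := by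
    intro x hx
    have : (0 : ℝ) < x := hx
    positivity
  have hlim : Tendsto (fun s : ℝ => -(1 / (c * (p - 1))) * (1 + c * s) ^ (1 - p)) atTop (𝓝 0) := by
    have h1 : Tendsto (fun s : ℝ => 1 + c * s) atTop atTop :=
      tendsto_atTop_add_const_left _ _ (tendsto_id.const_mul_atTop hc)
    have h2 := (tendsto_rpow_neg_atTop hp').comp h1
    have h3 := h2.const_mul (-(1 / (c * (p - 1))))
    simp only [mul_zero] at h3
    refine h3.congr fun s => ?_
    simp
  rw [← ofReal_integral_eq_lintegral_ofReal
      (integrableOn_Ioi_deriv_of_nonneg' hderiv hpos hlim)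
      ((ae_restrict_iff' measurableSet_Ioi).2 (ae_of_all _ hpos)),
    integral_Ioi_of_hasDerivAt_of_nonneg' hderiv hpos hlim]
  simp

variable {E F : Type*} [NormedAddCommGroup E] [InnerProductSpace ℝ E] [FiniteDimensional ℝ E]
  [NormedAddCommGroup F] [InnerProductSpace ℝ F] [FiniteDimensional ℝ F]
  [MeasurableSpace E] [BorelSpace E]

/-- The inverse second moment of a Gaussian vector `A (x₀ + σ g)` is controlled by the stable rank
of `A`, uniformly in the mean. -/
theorem lintegral_inv_normSq_le {ι : Type*} [Fintype ι] (A : E →L[ℝ] F)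
    (e : OrthonormalBasis ι ℝ E) {σ Λ : ℝ} (hσ : 0 < σ) (hΛ : 0 < Λ) (hAΛ : ‖A‖ ^ 2 ≤ Λ)
    (hA : 2 * Λ < ∑ j, ‖A (e j)‖ ^ 2) (x₀ : E) :
    ∫⁻ x, (ENNReal.ofReal (‖A (x₀ + σ • x)‖ ^ 2))⁻¹ ∂(stdGaussian E) ≤
      ENNReal.ofReal (1 / (σ ^ 2 * (∑ j, ‖A (e j)‖ ^ 2 - 2 * Λ))) := by
  obtain ⟨b, l, hl0, hl1, hAq, hsum⟩ := exists_orthonormalBasis_normSq_eq A e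
  rw [← hsum] at hA ⊢
  have hexp : ∀ x, ‖A (x₀ + σ • x)‖ ^ 2 = ∑ i, l i * (⟪b i, x₀⟫ + σ * ⟪b i, x⟫) ^ 2 := by
    intro x
    rw [hAq]
    simp [inner_add_right, inner_smul_right]
  have hq : ∀ x : Fin (Module.finrank ℝ E) → ℝ,
      0 ≤ ∑ i, l i * (⟪b i, x₀⟫ + σ * x i) ^ 2 := fun x =>
    Finset.sum_nonneg fun i _ => mul_nonneg (hl0 i) (sq_nonneg _)
  simp_rw [hexp]
  rw [← lintegral_map (μ := stdGaussian E) (g := fun x i => ⟪b i, x⟫)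
    (f := fun x : Fin (Module.finrank ℝ E) → ℝ =>
      (ENNReal.ofReal (∑ i, l i * (⟪b i, x₀⟫ + σ * x i) ^ 2))⁻¹) (by fun_prop) (by fun_prop),
    map_inner_stdGaussian]
  simp_rw [← lintegral_exp_neg_mul_Ioi (hq _)]
  rw [lintegral_lintegral_swap (by fun_prop)]
  -- Stable rank larger than 2 is exactly integrability at infinity of the Laplace transform bound.
  have hp : 1 < (∑ i, l i) / (2 * Λ) := by rw [lt_div_iff₀ (by positivity)]; linarith
  calc _ ≤ ∫⁻ s in Ioi (0 : ℝ), ENNReal.ofReal ((1 + 2 * σ ^ 2 * Λ * s) ^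
        (-((∑ i, l i) / (2 * Λ)) : ℝ)) :=
        setLIntegral_mono' measurableSet_Ioi fun s hs =>
          lintegral_exp_neg_weighted_sum_sq_le l _ σ (le_of_lt hs) hl0 hΛ
            fun i => (hl1 i).trans hAΛ
    _ = _ := by
        rw [lintegral_one_add_mul_rpow_neg (by positivity) hp]
        congr 2
        field_simp

end InverseMoments

/-! ### Spectral and Frobenius norms of matrices -/

section Matrices

variable {k m n : ℕ}

theorem act_add (A : Mat m n) (x y : Vec n) : act A (x + y) = act A x + act A y := by
  simp [act, Matrix.mulVec_add]

theorem act_smul (A : Mat m n) (c : ℝ) (x : Vec n) : act A (c • x) = c • act A x := by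
  simp [act, Matrix.mulVec_smul]

theorem add_act (A B : Mat m n) (x : Vec n) : act (A + B) x = act A x + act B x := by
  simp [act, Matrix.add_mulVec]

theorem smul_act (c : ℝ) (A : Mat m n) (x : Vec n) : act (c • A) x = c • act A x := by
  simp [act, Matrix.smul_mulVec]

theorem mul_act (A : Mat k m) (B : Mat m n) (x : Vec n) : act (A * B) x = act A (act B x) := by
  simp [act, Matrix.mulVec_mulVec]

/-- The matrix-vector product as a continuous linear map; its norm is the spectral norm. -/
noncomputable def actL (A : Mat m n) : Vec n →L[ℝ] Vec m :=
  LinearMap.toContinuousLinearMap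
    { toFun := act A, map_add' := act_add A, map_smul' := act_smul A }

@[simp] theorem actL_apply (A : Mat m n) (x : Vec n) : actL A x = act A x := rfl

theorem actL_add (A B : Mat m n) : actL (A + B) = actL A + actL B := by
  ext1 x; simp [add_act]

theorem actL_smul (c : ℝ) (A : Mat m n) : actL (c • A) = c • actL A := by
  ext1 x; simp [smul_act]

theorem norm_actL_mul_le (A : Mat k m) (B : Mat m n) : ‖actL (A * B)‖ ≤ ‖actL A‖ * ‖actL B‖ := by
  have : actL (A * B) = (actL A).comp (actL B) := by ext1 x; simp [mul_act]
  rw [this]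
  exact ContinuousLinearMap.opNorm_comp_le _ _

theorem inner_act_transpose (A : Mat m n) (x : Vec n) (y : Vec m) :
    ⟪act A.transpose y, x⟫ = ⟪y, act A x⟫ := by
  simp only [act, PiLp.inner_apply, Matrix.mulVec, dotProduct, Matrix.transpose_apply]
  simp only [RCLike.inner_apply, conj_trivial, Finset.mul_sum, Finset.sum_mul]
  rw [Finset.sum_comm]
  exact Finset.sum_congr rfl fun i _ => Finset.sum_congr rfl fun j _ => by ring

theorem norm_actL_transpose_le (A : Mat m n) : ‖actL A.transpose‖ ≤ ‖actL A‖ := by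
  refine ContinuousLinearMap.opNorm_le_bound _ (norm_nonneg _) fun y => ?_
  rw [actL_apply]
  rcases (norm_nonneg (act A.transpose y)).eq_or_lt with h | h
  · rw [← h]; positivity
  · refine le_of_mul_le_mul_right ?_ h
    rw [← sq, ← real_inner_self_eq_norm_sq, inner_act_transpose]
    calc ⟪y, act A (act A.transpose y)⟫ ≤ ‖y‖ * ‖act A (act A.transpose y)‖ :=
          real_inner_le_norm _ _
      _ ≤ ‖y‖ * (‖actL A‖ * ‖act A.transpose y‖) := by
          gcongr; exact (actL A).le_opNorm _
      _ = _ := by ring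

theorem frobSq_eq_sum_normSq (A : Mat m n) :
    frobSq A = ∑ j, ‖actL A (EuclideanSpace.basisFun (Fin n) ℝ j)‖ ^ 2 := by
  simp only [frobSq, frobInner]
  rw [Finset.sum_comm]
  refine Finset.sum_congr rfl fun j _ => ?_
  rw [EuclideanSpace.norm_sq_eq]
  refine Finset.sum_congr rfl fun i _ => ?_
  simp [act, sq]

theorem frobSq_nonneg (A : Mat m n) : 0 ≤ frobSq A := by
  unfold frobSq frobInner
  exact Finset.sum_nonneg fun _ _ => Finset.sum_nonneg fun _ _ => mul_self_nonneg _

theorem frobSq_transpose (A : Mat m n) : frobSq A.transpose = frobSq A := by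
  simp only [frobSq, frobInner, Matrix.transpose_apply]
  exact Finset.sum_comm

theorem frobSq_mul_le_left (A : Mat k m) (B : Mat m n) :
    frobSq (A * B) ≤ ‖actL A‖ ^ 2 * frobSq B := by
  rw [frobSq_eq_sum_normSq, frobSq_eq_sum_normSq, Finset.mul_sum]
  refine Finset.sum_le_sum fun j _ => ?_
  rw [← mul_pow]
  gcongr
  simp only [actL_apply, mul_act]
  exact (actL A).le_opNorm _

theorem frobSq_mul_le_right (A : Mat k m) (B : Mat m n) :
    frobSq (A * B) ≤ ‖actL B‖ ^ 2 * frobSq A := by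
  rw [← frobSq_transpose, Matrix.transpose_mul, ← frobSq_transpose A]
  refine (frobSq_mul_le_left _ _).trans ?_
  have := norm_actL_transpose_le B
  have := frobSq_nonneg A.transpose
  gcongr

theorem frobSq_le (A : Mat m n) : frobSq A ≤ n * ‖actL A‖ ^ 2 := by
  rw [frobSq_eq_sum_normSq]
  refine (Finset.sum_le_card_nsmul _ _ (‖actL A‖ ^ 2) fun j _ => ?_).trans (by simp)
  gcongr
  simpa using (actL A).le_opNorm (EuclideanSpace.basisFun (Fin n) ℝ j)

/-- A matrix as a vector of its entries. -/
noncomputable def vec (A : Mat m n) : EuclideanSpace ℝ (Fin m × Fin n) :=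
  WithLp.toLp 2 fun p => A p.1 p.2

theorem inner_vec (A B : Mat m n) : ⟪vec A, vec B⟫ = frobInner A B := by
  simp [vec, frobInner, PiLp.inner_apply, Fintype.sum_prod_type, mul_comm]

theorem norm_vec_sq (A : Mat m n) : ‖vec A‖ ^ 2 = frobSq A := by
  rw [← real_inner_self_eq_norm_sq, inner_vec, frobSq]

theorem vec_add (A B : Mat m n) : vec (A + B) = vec A + vec B := by ext p; simp [vec]

theorem vec_sub (A B : Mat m n) : vec (A - B) = vec A - vec B := by ext p; simp [vec]

theorem vec_smul (c : ℝ) (A : Mat m n) : vec (c • A) = c • vec A := by ext p; simp [vec]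

theorem norm_actL_le_norm_vec (A : Mat m n) : ‖actL A‖ ≤ ‖vec A‖ := by
  refine ContinuousLinearMap.opNorm_le_bound _ (norm_nonneg _) fun x => ?_
  refine abs_le_of_sq_le_sq' ?_ (by positivity) |>.2
  rw [mul_pow, norm_vec_sq, EuclideanSpace.norm_sq_eq, EuclideanSpace.norm_sq_eq, frobSq, frobInner,
    Finset.sum_mul]
  refine Finset.sum_le_sum fun i _ => ?_
  simp only [actL_apply, act, Matrix.mulVec, dotProduct, Real.norm_eq_abs, sq_abs, ← sq]
  exact Finset.sum_mul_sq_le_sq_mul_sq _ _ _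

theorem norm_vec_mul_le_left (A : Mat k m) (B : Mat m n) :
    ‖vec (A * B)‖ ≤ ‖actL A‖ * ‖vec B‖ := by
  refine abs_le_of_sq_le_sq' ?_ (by positivity) |>.2
  rw [mul_pow, norm_vec_sq, norm_vec_sq]
  exact frobSq_mul_le_left A B

theorem norm_vec_mul_le_right (A : Mat k m) (B : Mat m n) :
    ‖vec (A * B)‖ ≤ ‖actL B‖ * ‖vec A‖ := by
  refine abs_le_of_sq_le_sq' ?_ (by positivity) |>.2
  rw [mul_pow, norm_vec_sq, norm_vec_sq]
  exact frobSq_mul_le_right A B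

end Matrices

/-! ### The cosine loss and its variation -/

section Loss

variable {h d : ℕ}

open scoped MatrixOrder in
-- The multivariate Gaussian is an image of the standard one under the square root of the
-- covariance, and the positive square root of σ²I is σI.
theorem augLaw_eq_map {σ : ℝ} (hσ : 0 < σ) (x₀ : Vec d) :
    augLaw σ x₀ = (inputLaw d).map (fun g => x₀ + σ • g) := by
  have h1 : CFC.sqrt (σ ^ 2 • (1 : Matrix (Fin d) (Fin d) ℝ)) = σ • 1 := by
    rw [CFC.sqrt_eq_iff _ _ (ha := ?_) (hb := ?_)]
    · simp [smul_smul, sq]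
    · exact (Matrix.PosSemidef.one.smul (by positivity)).nonneg
    · exact (Matrix.PosSemidef.one.smul hσ.le).nonneg
  rw [augLaw, multivariateGaussian, h1, inputLaw]
  congr 1
  ext1 g
  simp

instance isProbabilityMeasure_inputLaw (d : ℕ) : IsProbabilityMeasure (inputLaw d) := by
  unfold inputLaw; infer_instance

instance isProbabilityMeasure_augLaw (σ : ℝ) (x₀ : Vec d) : IsProbabilityMeasure (augLaw σ x₀) := by
  unfold augLaw; infer_instance

/-- The integrand of the cosine loss in terms of the product `P` of the two nets, an anchor and the
noises of the two views. -/
noncomputable def cosTerm (σ : ℝ) (P Φt : Mat h d) (z : Vec d × Vec d × Vec d) : ℝ :=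
  -(⟪act P (z.1 + σ • z.2.1), act Φt (z.1 + σ • z.2.2)⟫ /
    (‖act P (z.1 + σ • z.2.1)‖ * ‖act Φt (z.1 + σ • z.2.2)‖))

theorem continuous_act (A : Mat h d) : Continuous (act A) := (actL A).continuous

@[fun_prop] theorem measurable_act (A : Mat h d) : Measurable (act A) :=
  (continuous_act A).measurable

theorem measurable_cosTerm (σ : ℝ) (P Φt : Mat h d) : Measurable (cosTerm σ P Φt) := by
  unfold cosTerm; fun_prop

theorem integrable_cosTerm (σ : ℝ) (P Φt : Mat h d) :
    Integrable (cosTerm σ P Φt) ((inputLaw d).prod ((inputLaw d).prod (inputLaw d))) := by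
  refine (integrable_const (1 : ℝ)).mono' (measurable_cosTerm σ P Φt).aestronglyMeasurable
    (ae_of_all _ fun z => ?_)
  rw [cosTerm, norm_neg]
  exact abs_real_inner_div_norm_mul_norm_le_one _ _

/-- The online branch enters only through the product `W * Φ`. Variations of either net therefore
become variations of that product and can be estimated together. -/
theorem cosLoss_eq_integral {σ : ℝ} (hσ : 0 < σ) (Φ : Mat h d) (W : Mat h h) (Φt : Mat h d) :
    cosLoss σ Φ W Φt =
      ∫ z, cosTerm σ (W * Φ) Φt z ∂((inputLaw d).prod ((inputLaw d).prod (inputLaw d))) := by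
  rw [integral_prod _ (integrable_cosTerm σ _ _), cosLoss]
  refine integral_congr_ae ?_
  filter_upwards [(integrable_cosTerm σ (W * Φ) Φt).prod_right_ae] with x₀ hx₀
  rw [integral_prod _ hx₀, augLaw_eq_map hσ, integral_map (by fun_prop)]
  · refine integral_congr_ae (ae_of_all _ fun g => ?_)
    simp only
    rw [integral_map (by fun_prop)]
    · simp [cosTerm, mul_act]
    · exact Measurable.aestronglyMeasurable (by fun_prop)
  · refine (StronglyMeasurable.aestronglyMeasurable ?_)
    refine StronglyMeasurable.integral_prod_right (f := fun x x' : Vec d =>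
      -(⟪act W (act Φ x), act Φt x'⟫ / (‖act W (act Φ x)‖ * ‖act Φt x'‖))) ?_
    apply Measurable.stronglyMeasurable
    fun_prop

/-- The difference of the unit vectors splits into a change of normalization and a change of vector,
each at most ‖a' - a‖/‖a‖. Only a has to be nonzero: for a' or b zero the convention 0/0 = 0 is
harmless. -/
theorem abs_cos_sub_cos_le {E : Type*} [NormedAddCommGroup E] [InnerProductSpace ℝ E]
    (a a' b : E) (ha : a ≠ 0) :
    |⟪a', b⟫ / (‖a'‖ * ‖b‖) - ⟪a, b⟫ / (‖a‖ * ‖b‖)| ≤ 2 * ‖a' - a‖ / ‖a‖ := by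
  have ha0 : 0 < ‖a‖ := norm_pos_iff.2 ha
  have h1 : ⟪a', b⟫ / (‖a'‖ * ‖b‖) - ⟪a, b⟫ / (‖a‖ * ‖b‖) =
      ⟪‖a'‖⁻¹ • a' - ‖a‖⁻¹ • a, ‖b‖⁻¹ • b⟫ := by
    rw [inner_sub_left, inner_smul_left, inner_smul_left, inner_smul_right, inner_smul_right]
    simp only [conj_trivial, div_eq_mul_inv, mul_inv]
    ring
  have h2 : ‖(‖a'‖⁻¹ - ‖a‖⁻¹) • a'‖ ≤ ‖a' - a‖ / ‖a‖ := by
    rcases eq_or_ne a' 0 with rfl | ha'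
    · simp; positivity
    · have ha0' : 0 < ‖a'‖ := norm_pos_iff.2 ha'
      rw [norm_smul, Real.norm_eq_abs, ← abs_of_pos ha0', ← abs_mul, abs_of_pos ha0']
      rw [show (‖a'‖⁻¹ - ‖a‖⁻¹) * ‖a'‖ = (‖a‖ - ‖a'‖) / ‖a‖ by field_simp, abs_div,
        abs_of_pos ha0, norm_sub_rev]
      gcongr
      exact abs_norm_sub_norm_le _ _
  have h3 : ‖‖a'‖⁻¹ • a' - ‖a‖⁻¹ • a‖ ≤ 2 * ‖a' - a‖ / ‖a‖ := by
    have : ‖a'‖⁻¹ • a' - ‖a‖⁻¹ • a = (‖a'‖⁻¹ - ‖a‖⁻¹) • a' + ‖a‖⁻¹ • (a' - a) := by module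
    rw [this]
    refine (norm_add_le _ _).trans ?_
    have h4 : ‖‖a‖⁻¹ • (a' - a)‖ = ‖a' - a‖ / ‖a‖ := by
      rw [norm_smul, norm_inv, norm_norm]; ring
    rw [h4]
    calc _ ≤ ‖a' - a‖ / ‖a‖ + ‖a' - a‖ / ‖a‖ := by gcongr
      _ = _ := by ring
  have h5 : ‖‖b‖⁻¹ • b‖ ≤ 1 := by
    rw [norm_smul, norm_inv, norm_norm]
    exact inv_mul_le_one
  rw [h1]
  calc _ ≤ ‖‖a'‖⁻¹ • a' - ‖a‖⁻¹ • a‖ * ‖‖b‖⁻¹ • b‖ := abs_real_inner_le_norm _ _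
    _ ≤ 2 * ‖a' - a‖ / ‖a‖ * 1 := by gcongr
    _ = _ := mul_one _

/-- Weighted AM-GM splits 2‖Dx‖/‖Px‖ into a second moment of Dx and an inverse second moment of Px,
which are integrated separately; θ is optimized only after integration. -/
theorem ofReal_abs_cosTerm_sub_le (σ s : ℝ) {θ : ℝ} (hθ : 0 < θ) (P D Φt : Mat h d)
    (z : Vec d × Vec d × Vec d) :
    ENNReal.ofReal |cosTerm σ (P + s • D) Φt z - cosTerm σ P Φt z| ≤
      ENNReal.ofReal |s| * (ENNReal.ofReal θ * ENNReal.ofReal (‖act D (z.1 + σ • z.2.1)‖ ^ 2) +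
        ENNReal.ofReal θ⁻¹ * (ENNReal.ofReal (‖act P (z.1 + σ • z.2.1)‖ ^ 2))⁻¹) := by
  set x := z.1 + σ • z.2.1
  set b := act Φt (z.1 + σ • z.2.2)
  rcases eq_or_ne s 0 with rfl | hs
  · simp
  -- If Px = 0 the right-hand side is infinite, because s ≠ 0 and θ > 0.
  rcases eq_or_ne (act P x) 0 with h0 | h0
  · rw [h0]
    simp [hθ, hs]
  have ha0 : 0 < ‖act P x‖ := norm_pos_iff.2 h0
  have h1 := abs_cos_sub_cos_le (act P x) (act (P + s • D) x) b h0
  have h2 : |cosTerm σ (P + s • D) Φt z - cosTerm σ P Φt z| =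
      |⟪act (P + s • D) x, b⟫ / (‖act (P + s • D) x‖ * ‖b‖) -
        ⟪act P x, b⟫ / (‖act P x‖ * ‖b‖)| := by
    rw [cosTerm, cosTerm, ← abs_neg]
    congr 1
    simp only [x, b]
    ring
  have h3 : act (P + s • D) x - act P x = s • act D x := by rw [add_act, smul_act]; abel
  rw [h2, ← ENNReal.ofReal_inv_of_pos (by positivity), ← ENNReal.ofReal_mul hθ.le,
    ← ENNReal.ofReal_mul (by positivity), ← ENNReal.ofReal_add (by positivity) (by positivity),
    ← ENNReal.ofReal_mul (abs_nonneg s)]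
  apply ENNReal.ofReal_le_ofReal
  refine h1.trans ?_
  rw [h3, norm_smul, Real.norm_eq_abs,
    show 2 * (|s| * ‖act D x‖) / ‖act P x‖ = |s| * (2 * ‖act D x‖ * ‖act P x‖⁻¹) by ring]
  gcongr
  have h5 : θ * ‖act D x‖ ^ 2 + θ⁻¹ * (‖act P x‖ ^ 2)⁻¹ - 2 * ‖act D x‖ * ‖act P x‖⁻¹ =
      θ * (‖act D x‖ - θ⁻¹ * ‖act P x‖⁻¹) ^ 2 := by
    field_simp; ring
  have h6 : 0 ≤ θ * (‖act D x‖ - θ⁻¹ * ‖act P x‖⁻¹) ^ 2 := by positivity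
  linarith

end Loss

/-! ### Frobenius bounds for the gradient of the cosine loss -/

section LossGradient

variable {h d : ℕ}

theorem lintegral_normSq_act_add_le (σ : ℝ) (D : Mat h d) :
    ∫⁻ z : Vec d × Vec d × Vec d, ENNReal.ofReal (‖act D (z.1 + σ • z.2.1)‖ ^ 2)
      ∂((inputLaw d).prod ((inputLaw d).prod (inputLaw d))) ≤
      ENNReal.ofReal (2 * (1 + σ ^ 2) * frobSq D) := by
  have hpt : ∀ z : Vec d × Vec d × Vec d, ENNReal.ofReal (‖act D (z.1 + σ • z.2.1)‖ ^ 2) ≤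
      ENNReal.ofReal 2 * ENNReal.ofReal (‖act D z.1‖ ^ 2) +
        ENNReal.ofReal (2 * σ ^ 2) * ENNReal.ofReal (‖act D z.2.1‖ ^ 2) := by
    intro z
    rw [← ENNReal.ofReal_mul (by positivity), ← ENNReal.ofReal_mul (by positivity),
      ← ENNReal.ofReal_add (by positivity) (by positivity)]
    apply ENNReal.ofReal_le_ofReal
    rw [act_add, act_smul]
    have h1 := norm_add_le (act D z.1) (σ • act D z.2.1)
    rw [norm_smul, Real.norm_eq_abs] at h1
    have h2 : ‖act D z.1 + σ • act D z.2.1‖ ^ 2 ≤ (‖act D z.1‖ + |σ| * ‖act D z.2.1‖) ^ 2 := by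
      gcongr
    nlinarith [sq_nonneg (‖act D z.1‖ - |σ| * ‖act D z.2.1‖), sq_abs σ]
  have h1 : ∫⁻ x, ENNReal.ofReal (‖act D x‖ ^ 2) ∂(inputLaw d) = ENNReal.ofReal (frobSq D) := by
    rw [frobSq_eq_sum_normSq]
    exact lintegral_normSq_stdGaussian (actL D) _
  refine (lintegral_mono hpt).trans (le_of_eq ?_)
  rw [lintegral_add_left (by fun_prop), lintegral_const_mul _ (by fun_prop),
    lintegral_const_mul _ (by fun_prop), lintegral_prod _ (by fun_prop),
    lintegral_prod _ (by fun_prop)]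
  simp only [lintegral_const, measure_univ, mul_one]
  have h2 : ∫⁻ y : Vec d × Vec d, ENNReal.ofReal (‖act D y.1‖ ^ 2)
      ∂((inputLaw d).prod (inputLaw d)) = ENNReal.ofReal (frobSq D) := by
    rw [lintegral_prod _ (by fun_prop)]
    simp only [lintegral_const, measure_univ, mul_one, h1]
  rw [h1, h2, ← ENNReal.ofReal_mul (by positivity), ← ENNReal.ofReal_mul (by positivity),
    ← ENNReal.ofReal_add]
  · congr 1; ring
  · have := frobSq_nonneg D; positivity
  · have := frobSq_nonneg D; positivity

theorem lintegral_inv_normSq_act_add_le {σ Λ : ℝ} (hσ : 0 < σ) (hΛ : 0 < Λ) (P : Mat h d)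
    (hPΛ : ‖actL P‖ ^ 2 ≤ Λ) (hP : 2 * Λ < frobSq P) :
    ∫⁻ z : Vec d × Vec d × Vec d, (ENNReal.ofReal (‖act P (z.1 + σ • z.2.1)‖ ^ 2))⁻¹
      ∂((inputLaw d).prod ((inputLaw d).prod (inputLaw d))) ≤
      ENNReal.ofReal (1 / (σ ^ 2 * (frobSq P - 2 * Λ))) := by
  rw [lintegral_prod _ (by fun_prop)]
  calc _ ≤ ∫⁻ x : Vec d, ENNReal.ofReal (1 / (σ ^ 2 * (frobSq P - 2 * Λ))) ∂(inputLaw d) := by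
        refine lintegral_mono fun x₀ => ?_
        simp only
        rw [lintegral_prod _ (by fun_prop)]
        simp only [lintegral_const, measure_univ, mul_one]
        rw [frobSq_eq_sum_normSq] at hP ⊢
        exact lintegral_inv_normSq_le (actL P) _ hσ hΛ hPΛ hP x₀
    _ = _ := by simp

theorem abs_integral_cosTerm_sub_le {σ Λ θ : ℝ} (hσ : 0 < σ) (hΛ : 0 < Λ) (hθ : 0 < θ) (s : ℝ)
    (P D Φt : Mat h d) (hPΛ : ‖actL P‖ ^ 2 ≤ Λ) (hP : 2 * Λ < frobSq P) :
    |∫ z, cosTerm σ (P + s • D) Φt z ∂((inputLaw d).prod ((inputLaw d).prod (inputLaw d))) -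
      ∫ z, cosTerm σ P Φt z ∂((inputLaw d).prod ((inputLaw d).prod (inputLaw d)))| ≤
    (θ * (2 * (1 + σ ^ 2) * frobSq D) + θ⁻¹ * (1 / (σ ^ 2 * (frobSq P - 2 * Λ)))) * |s| := by
  have hP' : 0 < frobSq P - 2 * Λ := by linarith
  have hD := frobSq_nonneg D
  rw [← integral_sub (integrable_cosTerm σ _ _) (integrable_cosTerm σ _ _), ← Real.norm_eq_abs]
  refine (norm_integral_le_lintegral_norm _).trans ?_
  refine ENNReal.toReal_le_of_le_ofReal (by positivity) ?_
  simp_rw [Real.norm_eq_abs]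
  refine (lintegral_mono fun z => ofReal_abs_cosTerm_sub_le σ s hθ P D Φt z).trans ?_
  rw [lintegral_const_mul _ (by fun_prop), lintegral_add_left (by fun_prop),
    lintegral_const_mul _ (by fun_prop), lintegral_const_mul _ (by fun_prop), mul_comm _ |s|,
    ENNReal.ofReal_mul (abs_nonneg s), ENNReal.ofReal_add (by positivity) (by positivity),
    ENNReal.ofReal_mul hθ.le, ENNReal.ofReal_mul (inv_pos.2 hθ).le]
  gcongr
  · exact lintegral_normSq_act_add_le σ D
  · exact lintegral_inv_normSq_act_add_le hσ hΛ P hPΛ hP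

theorem sq_le_of_forall_le_mul_add_inv_mul {x a b : ℝ} (hx : 0 ≤ x) (ha : 0 ≤ a) (hb : 0 < b)
    (h : ∀ θ : ℝ, 0 < θ → x ≤ θ * a + θ⁻¹ * b) : x ^ 2 ≤ 4 * a * b := by
  rcases hx.eq_or_lt with rfl | hx
  · simp; positivity
  -- This weight makes the second term x/2. It gives the same constant as the optimal √(b/a) without
  -- dividing by a, which may vanish.
  have h1 := h (2 * b / x) (by positivity)
  rw [inv_div, show x / (2 * b) * b = x / 2 by field_simp] at h1
  have h2 : x / 2 ≤ 2 * b / x * a := by linarith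
  have h3 : x / 2 * x ≤ 2 * b / x * a * x := by gcongr
  rw [show 2 * b / x * a * x = 2 * a * b by field_simp] at h3
  linarith

/-- A bound on the directional derivatives of the cosine loss. The direction `D` is that of the
product `P` of the two nets. -/
theorem sq_deriv_integral_cosTerm_le {σ Λ g : ℝ} (hσ : 0 < σ) (hΛ : 0 < Λ)
    (P D Φt : Mat h d) (hPΛ : ‖actL P‖ ^ 2 ≤ Λ) (hP : 2 * Λ < frobSq P)
    (hg : HasDerivAt (fun s : ℝ => ∫ z, cosTerm σ (P + s • D) Φt z
      ∂((inputLaw d).prod ((inputLaw d).prod (inputLaw d)))) g 0) :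
    g ^ 2 ≤ 8 * (1 + σ ^ 2) / σ ^ 2 * frobSq D / (frobSq P - 2 * Λ) := by
  have hP' : 0 < frobSq P - 2 * Λ := by linarith
  have hD := frobSq_nonneg D
  have h1 := sq_le_of_forall_le_mul_add_inv_mul (x := |g|)
    (a := 2 * (1 + σ ^ 2) * frobSq D) (b := 1 / (σ ^ 2 * (frobSq P - 2 * Λ)))
    (abs_nonneg g) (by positivity) (by positivity) fun θ hθ => by
      -- A derivative that is assumed to exist is bounded by the increments; no differentiation
      -- under the integral is needed.
      have h2 := hg.le_of_lip' (C := θ * (2 * (1 + σ ^ 2) * frobSq D) +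
        θ⁻¹ * (1 / (σ ^ 2 * (frobSq P - 2 * Λ)))) (by positivity) (Eventually.of_forall fun s => by
          simpa using abs_integral_cosTerm_sub_le hσ hΛ hθ s P D Φt hPΛ hP)
      simpa using h2
  rw [sq_abs] at h1
  refine h1.trans (le_of_eq ?_)
  field_simp
  ring

theorem hasDerivAt_frobSq_add_smul {m n : ℕ} (A V : Mat m n) :
    HasDerivAt (fun s : ℝ => frobSq (A + s • V)) (2 * frobInner A V) 0 := by
  have h1 : ∀ s : ℝ, frobSq (A + s • V) =
      frobSq A + s * (2 * frobInner A V) + s ^ 2 * frobSq V := by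
    intro s
    simp_rw [← norm_vec_sq, ← inner_vec, vec_add, vec_smul]
    rw [norm_add_sq_real, inner_smul_right, norm_smul, Real.norm_eq_abs, mul_pow, sq_abs]
    ring
  simp_rw [h1]
  have h2 := (((hasDerivAt_id (0 : ℝ)).mul_const (2 * frobInner A V)).const_add (frobSq A)).add
    (((hasDerivAt_id (0 : ℝ)).pow 2).mul_const (frobSq V))
  exact (h2.congr_deriv (by simp)).congr_of_eventuallyEq (Eventually.of_forall fun s => by simp)

theorem norm_vec_add_smul_sq {m n : ℕ} (ρ : ℝ) (A B : Mat m n) :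
    ‖vec (A + ρ • B)‖ ^ 2 =
      frobInner A (A + ρ • B) + ρ * frobInner B (A + ρ • B) := by
  rw [← real_inner_self_eq_norm_sq, ← inner_vec, ← inner_vec]
  nth_rewrite 1 [vec_add, vec_smul]
  rw [inner_add_left, inner_smul_left]
  simp

variable {σ ρ Λ : ℝ}

/-- Test the flow equation in the direction V = Φ' + ρΦ. After the weight decay is subtracted, the
cosine part has derivative -‖V‖_F². The derivative bound gives ‖V‖_F⁴ ≤ C‖WV‖_F² ≤ C‖W‖²‖V‖_F², and
one factor ‖V‖_F² cancels. -/
theorem normSq_velocity_rep_le (hσ : 0 < σ) (hΛ : 0 < Λ) (Φ Φ' : Mat h d) (W : Mat h h)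
    (hPΛ : ‖actL (W * Φ)‖ ^ 2 ≤ Λ) (hP : 2 * Λ < frobSq (W * Φ))
    (hderiv : ∀ V : Mat h d, HasDerivAt (fun s : ℝ => objective σ ρ (Φ + s • V) W Φ)
      (-(frobInner Φ' V)) 0) :
    ‖vec (Φ' + ρ • Φ)‖ ^ 2 ≤
      8 * (1 + σ ^ 2) / σ ^ 2 * ‖actL W‖ ^ 2 / (frobSq (W * Φ) - 2 * Λ) := by
  set V := Φ' + ρ • Φ with hV
  have h1 := (hderiv V).sub ((((hasDerivAt_frobSq_add_smul Φ V).add_const (frobSq W))).const_mul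
    (ρ / 2))
  have h2 : ∀ s : ℝ, W * (Φ + s • V) = W * Φ + s • (W * V) := fun s => by
    rw [Matrix.mul_add, Matrix.mul_smul]
  have h3 : HasDerivAt (fun s : ℝ => ∫ z, cosTerm σ (W * Φ + s • (W * V)) Φ z
      ∂((inputLaw d).prod ((inputLaw d).prod (inputLaw d)))) (-(‖vec V‖ ^ 2)) 0 := by
    refine (h1.congr_deriv ?_).congr_of_eventuallyEq (Eventually.of_forall fun s => ?_)
    · rw [hV, norm_vec_add_smul_sq]
      ring
    · simp only [objective, cosLoss_eq_integral hσ, h2, Pi.sub_apply]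
      ring
  have h4 := sq_deriv_integral_cosTerm_le hσ hΛ _ _ _ hPΛ hP h3
  have hP' : 0 < frobSq (W * Φ) - 2 * Λ := by linarith
  have h5 : frobSq (W * V) ≤ ‖actL W‖ ^ 2 * ‖vec V‖ ^ 2 := by
    rw [norm_vec_sq]; exact frobSq_mul_le_left W V
  rcases (sq_nonneg ‖vec V‖).eq_or_lt with h0 | h0
  · rw [← h0]; positivity
  · refine le_of_mul_le_mul_right ?_ h0
    calc _ = (-‖vec V‖ ^ 2) ^ 2 := by ring
      _ ≤ _ := h4
      _ ≤ 8 * (1 + σ ^ 2) / σ ^ 2 * (‖actL W‖ ^ 2 * ‖vec V‖ ^ 2) / (frobSq (W * Φ) - 2 * Λ) := by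
          gcongr
      _ = _ := by ring

/-- The same self-testing with V = W' + ρW. Only symmetric directions are admissible, so W and W'
have to be symmetric for V to be one. -/
theorem normSq_velocity_proj_le (hσ : 0 < σ) (hΛ : 0 < Λ) (Φ : Mat h d) (W W' : Mat h h)
    (hW : W.IsSymm) (hW' : W'.IsSymm)
    (hPΛ : ‖actL (W * Φ)‖ ^ 2 ≤ Λ) (hP : 2 * Λ < frobSq (W * Φ))
    (hderiv : ∀ V : Mat h h, V.IsSymm → HasDerivAt (fun s : ℝ => objective σ ρ Φ (W + s • V) Φ)
      (-(frobInner W' V)) 0) :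
    ‖vec (W' + ρ • W)‖ ^ 2 ≤
      8 * (1 + σ ^ 2) / σ ^ 2 * ‖actL Φ‖ ^ 2 / (frobSq (W * Φ) - 2 * Λ) := by
  set V := W' + ρ • W with hV
  have h1 := (hderiv V (hW'.add (hW.smul ρ))).sub
    ((((hasDerivAt_frobSq_add_smul W V).const_add (frobSq Φ))).const_mul (ρ / 2))
  have h2 : ∀ s : ℝ, (W + s • V) * Φ = W * Φ + s • (V * Φ) := fun s => by
    rw [Matrix.add_mul, Matrix.smul_mul]
  have h3 : HasDerivAt (fun s : ℝ => ∫ z, cosTerm σ (W * Φ + s • (V * Φ)) Φ z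
      ∂((inputLaw d).prod ((inputLaw d).prod (inputLaw d)))) (-(‖vec V‖ ^ 2)) 0 := by
    refine (h1.congr_deriv ?_).congr_of_eventuallyEq (Eventually.of_forall fun s => ?_)
    · rw [hV, norm_vec_add_smul_sq]
      ring
    · simp only [objective, cosLoss_eq_integral hσ, h2, Pi.sub_apply]
      ring
  have h4 := sq_deriv_integral_cosTerm_le hσ hΛ _ _ _ hPΛ hP h3
  have hP' : 0 < frobSq (W * Φ) - 2 * Λ := by linarith
  have h5 : frobSq (V * Φ) ≤ ‖actL Φ‖ ^ 2 * ‖vec V‖ ^ 2 := by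
    rw [norm_vec_sq]; exact frobSq_mul_le_right V Φ
  rcases (sq_nonneg ‖vec V‖).eq_or_lt with h0 | h0
  · rw [← h0]; positivity
  · refine le_of_mul_le_mul_right ?_ h0
    calc _ = (-‖vec V‖ ^ 2) ^ 2 := by ring
      _ ≤ _ := h4
      _ ≤ 8 * (1 + σ ^ 2) / σ ^ 2 * (‖actL Φ‖ ^ 2 * ‖vec V‖ ^ 2) / (frobSq (W * Φ) - 2 * Λ) := by
          gcongr
      _ = _ := by ring

end LossGradient

/-! ### Stability of the spectral norms along the flow -/

section Flow

theorem HasVelocity.hasDerivWithinAt_vec {m n : ℕ} {T t : ℝ} {A : ℝ → Mat m n} {A' : Mat m n}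
    (hA : HasVelocity T A A' t) :
    HasDerivWithinAt (fun s => vec (A s)) (vec A') (Icc 0 T) t := by
  have h1 : HasDerivWithinAt (fun s (p : Fin m × Fin n) => A s p.1 p.2)
      (fun p => A' p.1 p.2) (Icc 0 T) t := hasDerivWithinAt_pi.2 fun p => hA p.1 p.2
  exact (PiLp.continuousLinearEquiv 2 ℝ
    (fun _ : Fin m × Fin n => ℝ)).symm.hasFDerivAt.comp_hasDerivWithinAt t h1

/-- The integrating factor turns the velocity into a multiple of A' + ρA, the quantity bounded by
the gradient estimates; subtracting `vec (A 0)` makes the curve start at zero. -/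
theorem HasVelocity.hasDerivWithinAt_exp_smul_vec {m n : ℕ} {T t : ℝ} {A : ℝ → Mat m n}
    {A' : Mat m n} (hA : HasVelocity T A A' t) (ρ : ℝ) :
    HasDerivWithinAt (fun s => Real.exp (ρ * s) • vec (A s) - vec (A 0))
      (Real.exp (ρ * t) • vec (A' + ρ • A t)) (Icc 0 T) t := by
  have h1 : HasDerivWithinAt (fun s => Real.exp (ρ * s)) (Real.exp (ρ * t) * ρ) (Icc 0 T) t := by
    have := ((hasDerivAt_id t).const_mul ρ).exp
    simpa using this.hasDerivWithinAt
  refine ((h1.smul hA.hasDerivWithinAt_vec).sub_const (vec (A 0))).congr_deriv ?_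
  rw [vec_add, vec_smul]
  module

/-- Entries (i, j) and (j, i) are the same function on the interval, and derivatives within it are
unique when T > 0. For T = 0 every matrix would be a velocity. -/
theorem HasVelocity.isSymm {n : ℕ} {T t : ℝ} (hT : 0 < T) (ht : t ∈ Icc 0 T) {A : ℝ → Mat n n}
    {A' : Mat n n} (hA : HasVelocity T A A' t) (hsymm : ∀ s ∈ Icc 0 T, (A s).IsSymm) :
    A'.IsSymm := by
  ext i j
  refine UniqueDiffWithinAt.eq_deriv _ (uniqueDiffOn_Icc hT t ht) (hA j i) ?_
  exact (hA i j).congr (fun s hs => (hsymm s hs).apply i j) ((hsymm t ht).apply i j)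

/-- Perturbing both factors by matrices of Frobenius norm at most one changes the product by at
most `2 K + 1` in Frobenius norm. -/
theorem norm_vec_mul_sub_mul_le {k m n : ℕ} {A A₀ : Mat k m} {B B₀ : Mat m n} {K : ℝ}
    (hA₀ : ‖actL A₀‖ ≤ K) (hB₀ : ‖actL B₀‖ ≤ K)
    (hA : ‖vec (A - A₀)‖ ≤ 1) (hB : ‖vec (B - B₀)‖ ≤ 1) :
    ‖vec (A * B - A₀ * B₀)‖ ≤ 2 * K + 1 := by
  have hK : 0 ≤ K := (norm_nonneg _).trans hA₀
  have h1 : A * B - A₀ * B₀ = A₀ * (B - B₀) + (A - A₀) * B₀ + (A - A₀) * (B - B₀) := by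
    simp only [Matrix.mul_sub, Matrix.sub_mul]; abel
  rw [h1, vec_add, vec_add]
  refine norm_add₃_le.trans ?_
  have h2 := norm_vec_mul_le_left A₀ (B - B₀)
  have h3 := norm_vec_mul_le_right (A - A₀) B₀
  have h4 := norm_vec_mul_le_left (A - A₀) (B - B₀)
  have h5 := norm_actL_le_norm_vec (A - A₀)
  have h6 := norm_nonneg (vec (A - A₀))
  have h7 := norm_nonneg (vec (B - B₀))
  have h8 := norm_nonneg (actL A₀)
  have h9 := norm_nonneg (actL B₀)
  have h10 : ‖actL A₀‖ * ‖vec (B - B₀)‖ ≤ K * 1 := by gcongr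
  have h11 : ‖actL B₀‖ * ‖vec (A - A₀)‖ ≤ K * 1 := by gcongr
  have h12 : ‖actL (A - A₀)‖ * ‖vec (B - B₀)‖ ≤ 1 * 1 := by gcongr; exact h5.trans hA
  linarith

theorem norm_actL_le_of_norm_vec_sub_le {m n : ℕ} {A A₀ : Mat m n} {K : ℝ} (hA₀ : ‖actL A₀‖ ≤ K)
    (hA : ‖vec (A - A₀)‖ ≤ 1) : ‖actL A‖ ≤ K + 1 := by
  have h1 : actL A = actL A₀ + actL (A - A₀) := by rw [← actL_add]; congr 1; abel
  rw [h1]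
  exact (norm_add_le _ _).trans (add_le_add hA₀ ((norm_actL_le_norm_vec _).trans hA))

/-- If the nets `Φ`, `W` are, up to a positive scalar `c`, within Frobenius distance one of nets
with spectral norm at most `K` and a product of large Frobenius norm `p`, then the product has large
stable rank. -/
theorem stableRank_mul_of_near {h d : ℕ} {Φ Φ₀ : Mat h d} {W W₀ : Mat h h} {K c p : ℝ}
    (hK : 1 ≤ K) (hc : 0 < c)
    (hΦ₀ : ‖actL Φ₀‖ ≤ K) (hW₀ : ‖actL W₀‖ ≤ K) (hp : p ≤ ‖vec (W₀ * Φ₀)‖)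
    (hpK : 4 * (K + 1) ^ 2 ≤ p)
    (hΦ : ‖vec (c • Φ - Φ₀)‖ ≤ 1) (hW : ‖vec (c • W - W₀)‖ ≤ 1) :
    ‖actL Φ‖ ≤ c⁻¹ * (K + 1) ∧ ‖actL W‖ ≤ c⁻¹ * (K + 1) ∧
      ‖actL (W * Φ)‖ ^ 2 ≤ (c ^ 4)⁻¹ * (K + 1) ^ 4 ∧
      (c ^ 4)⁻¹ * (p ^ 2 / 8) ≤ frobSq (W * Φ) - 2 * ((c ^ 4)⁻¹ * (K + 1) ^ 4) := by
  have h1 := norm_actL_le_of_norm_vec_sub_le hΦ₀ hΦ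
  have h2 := norm_actL_le_of_norm_vec_sub_le hW₀ hW
  rw [actL_smul, norm_smul, Real.norm_eq_abs, abs_of_pos hc] at h1 h2
  have h1' : ‖actL Φ‖ ≤ c⁻¹ * (K + 1) := by rw [inv_mul_eq_div, le_div_iff₀ hc]; linarith
  have h2' : ‖actL W‖ ≤ c⁻¹ * (K + 1) := by rw [inv_mul_eq_div, le_div_iff₀ hc]; linarith
  refine ⟨h1', h2', ?_, ?_⟩
  · calc ‖actL (W * Φ)‖ ^ 2 ≤ (‖actL W‖ * ‖actL Φ‖) ^ 2 := by
          gcongr; exact norm_actL_mul_le W Φ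
      _ ≤ (c⁻¹ * (K + 1) * (c⁻¹ * (K + 1))) ^ 2 := by gcongr
      _ = _ := by field_simp
  · have h3 := norm_vec_mul_sub_mul_le hW₀ hΦ₀ hW hΦ
    have h4 : c • W * c • Φ = c ^ 2 • (W * Φ) := by
      rw [Matrix.smul_mul, Matrix.mul_smul, smul_smul, sq]
    rw [h4, vec_sub, vec_smul, norm_sub_rev] at h3
    have h5 := norm_sub_norm_le (vec (W₀ * Φ₀)) (c ^ 2 • vec (W * Φ))
    rw [norm_smul, norm_pow, Real.norm_eq_abs, abs_of_pos hc] at h5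
    -- The product moves by at most 2K + 1, which is at most p/2 since p ≥ 4(K + 1)².
    have h6 : p / 2 ≤ c ^ 2 * ‖vec (W * Φ)‖ := by nlinarith
    have h7 : (p / 2) ^ 2 ≤ (c ^ 2 * ‖vec (W * Φ)‖) ^ 2 := by
      have : 0 ≤ p := le_trans (by positivity) hpK
      gcongr
    rw [mul_pow, norm_vec_sq] at h7
    have h8 : (4 * (K + 1) ^ 2) ^ 2 ≤ p ^ 2 := by gcongr
    -- Of the available p²/4, half pays for 2(K + 1)⁴, because p² ≥ 16(K + 1)⁴.
    have h9 : p ^ 2 / 8 ≤ c ^ 4 * frobSq (W * Φ) - 2 * (K + 1) ^ 4 := by nlinarith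
    calc _ ≤ (c ^ 4)⁻¹ * (c ^ 4 * frobSq (W * Φ) - 2 * (K + 1) ^ 4) := by gcongr
      _ = _ := by field_simp

/-- Along the gradient flow the spectral norms of the nets stay bounded if they are bounded at
initialization and the product of the nets has large Frobenius norm there. -/
theorem IsSymmetricGradientFlow.norm_actL_le {h d : ℕ} {σ ρ T K p : ℝ} (hσ : 0 < σ) (hρ : 0 < ρ)
    {Φ : ℝ → Mat h d} {W : ℝ → Mat h h} (hflow : IsSymmetricGradientFlow σ ρ T Φ W)
    (hK : 1 ≤ K) (hΦ₀ : ‖actL (Φ 0)‖ ≤ K) (hW₀ : ‖actL (W 0)‖ ≤ K)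
    (hp : p ≤ ‖vec (W 0 * Φ 0)‖) (hpK : 4 * (K + 1) ^ 2 ≤ p)
    (hpT : 64 * (1 + σ ^ 2) / σ ^ 2 * (K + 1) ^ 2 * Real.exp (ρ * T) ^ 4 * T ^ 2 < p ^ 2)
    {t : ℝ} (ht : t ∈ Icc 0 T) :
    ‖actL (Φ t)‖ ≤ K + 1 ∧ ‖actL (W t)‖ ≤ K + 1 := by
  have hp0 : 0 < p := lt_of_lt_of_le (by positivity) hpK
  rcases (ht.1.trans ht.2).eq_or_lt with hT | hT
  · have : t = 0 := le_antisymm (hT ▸ ht.2) ht.1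
    rw [this]
    constructor <;> linarith
  have hex : ∀ s, ∃ Φ' : Mat h d, ∃ W' : Mat h h, s ∈ Icc 0 T → HasVelocity T Φ Φ' s ∧
      HasVelocity T W W' s ∧
      (∀ V : Mat h d, HasDerivAt (fun r : ℝ => objective σ ρ (Φ s + r • V) (W s) (Φ s))
        (-(frobInner Φ' V)) 0) ∧
      (∀ V : Mat h h, V.IsSymm →
        HasDerivAt (fun r : ℝ => objective σ ρ (Φ s) (W s + r • V) (Φ s))
          (-(frobInner W' V)) 0) := by
    intro s
    by_cases hs : s ∈ Icc 0 T
    · obtain ⟨Φ', h1, h2⟩ := hflow.flow_rep s hs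
      obtain ⟨W', h3, h4⟩ := hflow.flow_proj s hs
      exact ⟨Φ', W', fun _ => ⟨h1, h3, h2, h4⟩⟩
    · exact ⟨0, 0, fun h => absurd h hs⟩
  choose Φ' W' hv using hex
  -- Joint displacement of the rescaled nets; the product carries the maximum norm, so ‖f s‖ ≤ 1
  -- controls both.
  let f : ℝ → EuclideanSpace ℝ (Fin h × Fin d) × EuclideanSpace ℝ (Fin h × Fin h) := fun s =>
    (Real.exp (ρ * s) • vec (Φ s) - vec (Φ 0), Real.exp (ρ * s) • vec (W s) - vec (W 0))
  let f' : ℝ → EuclideanSpace ℝ (Fin h × Fin d) × EuclideanSpace ℝ (Fin h × Fin h) := fun s =>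
    (Real.exp (ρ * s) • vec (Φ' s + ρ • Φ s), Real.exp (ρ * s) • vec (W' s + ρ • W s))
  have hf : ∀ s ∈ Icc 0 T, HasDerivWithinAt f (f' s) (Icc 0 T) s := fun s hs =>
    ((hv s hs).1.hasDerivWithinAt_exp_smul_vec ρ).prodMk
      ((hv s hs).2.1.hasDerivWithinAt_exp_smul_vec ρ)
  have hfst : ∀ s, ‖f s‖ ≤ 1 → ‖vec (Real.exp (ρ * s) • Φ s - Φ 0)‖ ≤ 1 := fun s hs => by
    rw [vec_sub, vec_smul]; exact (norm_fst_le (f s)).trans hs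
  have hsnd : ∀ s, ‖f s‖ ≤ 1 → ‖vec (Real.exp (ρ * s) • W s - W 0)‖ ≤ 1 := fun s hs => by
    rw [vec_sub, vec_smul]; exact (norm_snd_le (f s)).trans hs
  -- As long as the displacement is at most one, the product keeps its large stable rank and the
  -- speed stays below 1/T.
  have hbound : ∀ s ∈ Icc 0 T, ‖f s‖ ≤ 1 → ‖f' s‖ < 1 / T := by
    intro s hs hfs
    set c := Real.exp (ρ * s) with hc
    have hc0 : 0 < c := Real.exp_pos _
    have hcT : c ≤ Real.exp (ρ * T) := Real.exp_le_exp.2 (by nlinarith [hs.2])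
    obtain ⟨h1, h2, h3, h4⟩ := stableRank_mul_of_near hK hc0 hΦ₀ hW₀ hp hpK (hfst s hfs) (hsnd s hfs)
    obtain ⟨h5, h6, h7, h8⟩ := hv s hs
    have hgap : 0 < (c ^ 4)⁻¹ * (p ^ 2 / 8) := by positivity
    have hfin : ∀ a x : ℝ, 0 ≤ a → a ≤ c⁻¹ * (K + 1) → 0 ≤ x →
        x ^ 2 ≤ 8 * (1 + σ ^ 2) / σ ^ 2 * a ^ 2 /
          (frobSq (W s * Φ s) - 2 * ((c ^ 4)⁻¹ * (K + 1) ^ 4)) → c * x < 1 / T := by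
      intro a x ha0 ha hx0 hx
      have h9 : x ^ 2 ≤ 8 * (1 + σ ^ 2) / σ ^ 2 * (c⁻¹ * (K + 1)) ^ 2 /
          ((c ^ 4)⁻¹ * (p ^ 2 / 8)) := hx.trans (by gcongr)
      refine lt_of_pow_lt_pow_left₀ 2 (by positivity) ?_
      calc (c * x) ^ 2 = c ^ 2 * x ^ 2 := by ring
        _ ≤ c ^ 2 * (8 * (1 + σ ^ 2) / σ ^ 2 * (c⁻¹ * (K + 1)) ^ 2 /
          ((c ^ 4)⁻¹ * (p ^ 2 / 8))) := by gcongr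
        _ = 64 * (1 + σ ^ 2) / σ ^ 2 * (K + 1) ^ 2 * c ^ 4 / p ^ 2 := by field_simp; ring
        _ ≤ 64 * (1 + σ ^ 2) / σ ^ 2 * (K + 1) ^ 2 * Real.exp (ρ * T) ^ 4 / p ^ 2 := by gcongr
        _ < (1 / T) ^ 2 := by
          rw [one_div, inv_pow, div_lt_iff₀ (by positivity), inv_mul_eq_div,
            lt_div_iff₀ (by positivity)]
          exact hpT
    have hΛ : 0 < (c ^ 4)⁻¹ * (K + 1) ^ 4 := by positivity
    have hlt : 2 * ((c ^ 4)⁻¹ * (K + 1) ^ 4) < frobSq (W s * Φ s) := by linarith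
    have h10 := normSq_velocity_rep_le hσ hΛ (Φ s) (Φ' s) (W s) h3 hlt h7
    have h11 := normSq_velocity_proj_le hσ hΛ (Φ s) (W s) (W' s) (hflow.symm s hs)
      (h6.isSymm hT hs hflow.symm) h3 hlt h8
    rw [Prod.norm_def]
    refine max_lt ?_ ?_
    · simp only [f', norm_smul, Real.norm_eq_abs, ← hc, abs_of_pos hc0]
      exact hfin _ _ (norm_nonneg _) h2 (norm_nonneg _) h10
    · simp only [f', norm_smul, Real.norm_eq_abs, ← hc, abs_of_pos hc0]
      exact hfin _ _ (norm_nonneg _) h1 (norm_nonneg _) h11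
  -- Barrier argument: where ‖f s‖ meets the line s/T it is at most 1, so its speed is less than the
  -- slope 1/T and it cannot cross.
  have hmain : ∀ ⦃s⦄, s ∈ Icc 0 T → ‖f s‖ ≤ s / T := by
    refine image_norm_le_of_norm_deriv_right_lt_deriv_boundary (f' := f') (B' := fun _ => 1 / T)
      (fun s hs => (hf s hs).continuousWithinAt) (fun s hs => ?_) ?_ (fun s => ?_) ?_
    · exact ((hf s ⟨hs.1, hs.2.le⟩).mono (Icc_subset_Icc_left hs.1)).mono_of_mem_nhdsWithin
        (Icc_mem_nhdsGE hs.2)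
    · simp [f]
    · exact (hasDerivAt_id s).div_const T
    · intro s hs hfs
      exact hbound s ⟨hs.1, hs.2.le⟩ (hfs.le.trans ((div_le_one hT).2 hs.2.le))
  have hft : ‖f t‖ ≤ 1 := (hmain ht).trans ((div_le_one hT).2 ht.2)
  obtain ⟨h1, h2, -, -⟩ := stableRank_mul_of_near hK (Real.exp_pos (ρ * t)) hΦ₀ hW₀ hp hpK
    (hfst t hft) (hsnd t hft)
  -- Undoing the rescaling only shrinks the nets, as ρ and t are nonnegative.
  have hc : (Real.exp (ρ * t))⁻¹ ≤ 1 := inv_le_one_of_one_le₀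
    (Real.one_le_exp (mul_nonneg hρ.le ht.1))
  have hc2 : (Real.exp (ρ * t))⁻¹ * (K + 1) ≤ 1 * (K + 1) := by gcongr
  constructor <;> linarith

end Flow

/-! ### Nets and the spectral norm -/

section Nets

/-- The ball of radius two in `ℝⁿ` has a `1`-net with at most `5 ^ n` elements. -/
theorem exists_finset_net (n : ℕ) : ∃ N : Finset (Vec n), N.card ≤ 5 ^ n ∧
    (∀ v ∈ N, ‖v‖ ≤ 2) ∧ ∀ x : Vec n, ‖x‖ ≤ 2 → ∃ v ∈ N, ‖x - v‖ ≤ 1 := by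
  classical
  let S : Set ℕ := {k | ∃ N : Finset (Vec n), N.card = k ∧ (∀ v ∈ N, ‖v‖ ≤ 2) ∧
    ∀ v ∈ N, ∀ w ∈ N, v ≠ w → 1 ≤ ‖v - w‖}
  have hbound : ∀ k ∈ S, k ≤ 5 ^ n := by
    rintro k ⟨N, rfl, h1, h2⟩
    simpa using Besicovitch.card_le_of_separated N h1 h2
  -- Take a separated family of largest cardinality, which the volume bound makes possible. A point
  -- not covered by it could be added, so it is a net.
  have hS : sSup S ∈ S := Nat.sSup_mem ⟨0, ∅, by simp⟩ ⟨5 ^ n, hbound⟩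
  obtain ⟨N, hN, h1, h2⟩ := hS
  refine ⟨N, hN ▸ hbound _ ⟨N, hN, h1, h2⟩, h1, fun x hx => ?_⟩
  by_contra! hcon
  have hxN : x ∉ N := fun h => by
    have := hcon x h
    norm_num at this
  have hmem : N.card + 1 ∈ S := by
    refine ⟨insert x N, Finset.card_insert_of_notMem hxN, ?_, ?_⟩
    · simpa [hx] using h1
    · intro v hv w hw hvw
      rcases Finset.mem_insert.1 hv with hv' | hv' <;> rcases Finset.mem_insert.1 hw with hw' | hw'
      · exact absurd (hv'.trans hw'.symm) hvw
      · exact hv' ▸ (hcon w hw').le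
      · rw [norm_sub_rev]; exact hw' ▸ (hcon v hv').le
      · exact h2 v hv' w hw' hvw
  have := le_csSup ⟨5 ^ n, hbound⟩ hmem
  omega

/-- Approximating 2x for a unit vector x gives 2‖Ax‖ ≤ r + ‖A‖, and the ‖A‖ on the right is
absorbed. -/
theorem norm_le_of_net {n : ℕ} {F : Type*} [NormedAddCommGroup F] [NormedSpace ℝ F]
    (A : Vec n →L[ℝ] F) {N : Finset (Vec n)}
    (hN : ∀ x : Vec n, ‖x‖ ≤ 2 → ∃ v ∈ N, ‖x - v‖ ≤ 1) {r : ℝ} (hr : 0 ≤ r)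
    (hA : ∀ v ∈ N, ‖A v‖ ≤ r) : ‖A‖ ≤ r := by
  have h1 : ‖A‖ ≤ (r + ‖A‖) / 2 := by
    refine ContinuousLinearMap.opNorm_le_of_unit_norm (by positivity) fun x hx => ?_
    obtain ⟨v, hv, hxv⟩ := hN ((2 : ℝ) • x) (by rw [norm_smul, hx]; norm_num)
    have h2 : A ((2 : ℝ) • x) = A v + A ((2 : ℝ) • x - v) := by rw [map_sub]; abel
    have h3 : ‖A ((2 : ℝ) • x)‖ = 2 * ‖A x‖ := by rw [map_smul, norm_smul]; norm_num
    have h4 : ‖A ((2 : ℝ) • x - v)‖ ≤ ‖A‖ * 1 := (A.le_opNorm _).trans (by gcongr)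
    have h5 := norm_add_le (A v) (A ((2 : ℝ) • x - v))
    rw [← h2, h3] at h5
    linarith [hA v hv]
  linarith

/-- The net argument is applied to both arguments of the bilinear form. One-sided bounds suffice
because u approximates 2Av/‖Av‖, where the form is positive. -/
theorem norm_actL_le_of_nets {m n : ℕ} (A : Mat m n) {M : Finset (Vec m)} {N : Finset (Vec n)}
    (hM : ∀ x : Vec m, ‖x‖ ≤ 2 → ∃ v ∈ M, ‖x - v‖ ≤ 1)
    (hN : ∀ x : Vec n, ‖x‖ ≤ 2 → ∃ v ∈ N, ‖x - v‖ ≤ 1) {r : ℝ} (hr : 0 ≤ r)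
    (hA : ∀ u ∈ M, ∀ v ∈ N, ⟪u, act A v⟫ ≤ r) : ‖actL A‖ ≤ r := by
  refine norm_le_of_net _ hN hr fun v hv => ?_
  rw [actL_apply]
  rcases (norm_nonneg (act A v)).eq_or_lt with h0 | h0
  · rw [← h0]; exact hr
  set y := act A v with hy
  obtain ⟨u, hu, hyu⟩ := hM ((2 / ‖y‖) • y) (by
    rw [norm_smul, Real.norm_eq_abs, abs_of_pos (by positivity)]
    exact (div_mul_cancel₀ _ h0.ne').le)
  have h1 := hA u hu v hv
  have h2 : ⟪(2 / ‖y‖) • y - u, y⟫ ≤ 1 * ‖y‖ :=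
    (real_inner_le_norm _ _).trans (by gcongr)
  rw [inner_sub_left, inner_smul_left, real_inner_self_eq_norm_sq] at h2
  have h3 : (starRingEnd ℝ) (2 / ‖y‖) * ‖y‖ ^ 2 = 2 * ‖y‖ := by
    simp only [conj_trivial]; field_simp
  rw [h3] at h2
  linarith

end Nets

/-! ### Gaussian matrices with repeated entries -/

section GaussianMatrices

/-- The law of a family of independent standard Gaussian variables. -/
noncomputable abbrev stdPi (ι : Type*) [Fintype ι] : Measure (ι → ℝ) :=
  Measure.pi fun _ : ι => gaussianReal 0 1

theorem hasSubgaussianMGF_id_gaussianReal :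
    HasSubgaussianMGF (fun x : ℝ => x) 1 (gaussianReal 0 1) where
  integrable_exp_mul t := integrable_exp_mul_gaussianReal t
  mgf_le t := by rw [mgf_fun_id_gaussianReal]; simp

theorem stdPi_linear_form_ge_le {κ : Type*} [Fintype κ] (c : κ → ℝ) {C r : ℝ} (hC : 0 < C)
    (hc : ∑ k, c k ^ 2 ≤ C) (hr : 0 ≤ r) :
    stdPi κ {x | r ≤ ∑ k, c k * x k} ≤ ENNReal.ofReal (Real.exp (-r ^ 2 / (2 * C))) := by
  have hind : iIndepFun (fun k (x : κ → ℝ) => c k * x k) (stdPi κ) :=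
    iIndepFun_pi (X := fun k (y : ℝ) => c k * y) fun k => by fun_prop
  have hsub : ∀ k ∈ (Finset.univ : Finset κ), HasSubgaussianMGF (fun x : κ → ℝ => c k * x k)
      (⟨c k ^ 2, sq_nonneg _⟩ * 1) (stdPi κ) := fun k _ => by
    refine HasSubgaussianMGF.const_mul ?_ (c k)
    have h1 := hasSubgaussianMGF_id_gaussianReal
    rw [← (measurePreserving_eval (fun _ : κ => gaussianReal 0 1) k).map_eq] at h1
    have h2 := HasSubgaussianMGF.of_map (X := fun x : ℝ => x) (c := 1) (μ := stdPi κ)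
      (Y := Function.eval k) (measurable_pi_apply k).aemeasurable h1
    exact h2
  have hsum := HasSubgaussianMGF.sum_of_iIndepFun hind hsub
  have hsum' : HasSubgaussianMGF (fun x : κ → ℝ => ∑ k, c k * x k) ⟨C, hC.le⟩ (stdPi κ) := by
    refine ⟨hsum.integrable_exp_mul, fun t => (hsum.mgf_le t).trans ?_⟩
    apply Real.exp_le_exp.2
    gcongr
    rw [NNReal.coe_sum]
    refine (Finset.sum_congr rfl fun k _ => ?_).trans_le hc
    change c k ^ 2 * (1 : ℝ) = c k ^ 2
    ring
  have h2 := hsum'.measure_ge_le hr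
  rw [← ofReal_measureReal]
  exact ENNReal.ofReal_le_ofReal h2

/-- Collect the coefficients of each independent variable; Cauchy-Schwarz on a fibre of at most two
elements costs the factor 2. This treats independent and symmetric matrices alike. -/
theorem stdPi_fiber_linear_form_ge_le {P κ : Type*} [Fintype P] [Fintype κ] [DecidableEq κ]
    (φ : P → κ) (hφ : ∀ k, (Finset.univ.filter fun p => φ p = k).card ≤ 2) (a : P → ℝ) {C r : ℝ}
    (hC : 0 < C) (ha : 2 * ∑ p, a p ^ 2 ≤ C) (hr : 0 ≤ r) :
    stdPi κ {x | r ≤ ∑ p, a p * x (φ p)} ≤ ENNReal.ofReal (Real.exp (-r ^ 2 / (2 * C))) := by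
  have h1 : ∀ x : κ → ℝ, ∑ p, a p * x (φ p) =
      ∑ k, (∑ p ∈ Finset.univ.filter fun p => φ p = k, a p) * x k := by
    intro x
    rw [← Finset.sum_fiberwise Finset.univ φ]
    refine Finset.sum_congr rfl fun k _ => ?_
    rw [Finset.sum_mul]
    refine Finset.sum_congr rfl fun p hp => ?_
    rw [(Finset.mem_filter.1 hp).2]
  simp_rw [h1]
  refine stdPi_linear_form_ge_le _ hC (le_trans ?_ ha) hr
  rw [← Finset.sum_fiberwise Finset.univ φ, Finset.mul_sum]
  refine Finset.sum_le_sum fun k _ => sq_sum_le_card_mul_sum_sq.trans ?_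
  have h2 : ((Finset.univ.filter fun p => φ p = k).card : ℝ) ≤ 2 := by exact_mod_cast hφ k
  have h3 : 0 ≤ ∑ p ∈ Finset.univ.filter (fun p => φ p = k), a p ^ 2 :=
    Finset.sum_nonneg fun _ _ => sq_nonneg _
  gcongr

/-- The matrix with entries `x (φ (i, j)) / √N`. -/
noncomputable def patternMat {m n : ℕ} {κ : Type*} (φ : Fin m × Fin n → κ) (N : ℝ) (x : κ → ℝ) :
    Mat m n :=
  Matrix.of fun i j => (√N)⁻¹ * x (φ (i, j))

theorem inner_act_patternMat {m n : ℕ} {κ : Type*} (φ : Fin m × Fin n → κ) (N : ℝ) (x : κ → ℝ)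
    (u : Vec m) (v : Vec n) :
    ⟪u, act (patternMat φ N x) v⟫ = (√N)⁻¹ * ∑ p, (u p.1 * v p.2) * x (φ p) := by
  simp only [act, patternMat, PiLp.inner_apply, Matrix.mulVec, dotProduct, RCLike.inner_apply,
    conj_trivial, Matrix.of_apply, Fintype.sum_prod_type, Finset.mul_sum, Finset.sum_mul]
  exact Finset.sum_congr rfl fun i _ => Finset.sum_congr rfl fun j _ => by ring

/-- Spectral norm bound for Gaussian matrices in which every entry is repeated at most twice. -/
theorem stdPi_norm_patternMat_gt_le {m n : ℕ} {κ : Type*} [Fintype κ] [DecidableEq κ]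
    (φ : Fin m × Fin n → κ) (hφ : ∀ k, (Finset.univ.filter fun p => φ p = k).card ≤ 2)
    {N r : ℝ} (hN : 0 < N) (hr : 0 ≤ r) :
    stdPi κ {x | r < ‖actL (patternMat φ N x)‖} ≤
      ENNReal.ofReal (5 ^ m * 5 ^ n * Real.exp (-(N * r ^ 2 / 64))) := by
  obtain ⟨U, hUc, hU2, hU⟩ := exists_finset_net m
  obtain ⟨V, hVc, hV2, hV⟩ := exists_finset_net n
  have hsub : {x : κ → ℝ | r < ‖actL (patternMat φ N x)‖} ⊆
      ⋃ q ∈ U ×ˢ V, {x | √N * r ≤ ∑ p, (q.1 p.1 * q.2 p.2) * x (φ p)} := by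
    intro x hx
    by_contra hcon
    refine absurd (norm_actL_le_of_nets (patternMat φ N x) hU hV hr fun u hu v hv => ?_)
      (not_le.2 hx)
    rw [inner_act_patternMat]
    simp only [mem_iUnion, not_exists] at hcon
    have h1 := hcon (u, v) (Finset.mem_product.2 ⟨hu, hv⟩)
    rw [mem_ofPred_eq, not_le] at h1
    have h2 : 0 < √N := Real.sqrt_pos.2 hN
    rw [inv_mul_le_iff₀ h2]
    exact h1.le
  have hterm : ∀ q ∈ U ×ˢ V, stdPi κ {x | √N * r ≤ ∑ p, (q.1 p.1 * q.2 p.2) * x (φ p)} ≤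
      ENNReal.ofReal (Real.exp (-(N * r ^ 2 / 64))) := by
    intro q hq
    obtain ⟨hu, hv⟩ := Finset.mem_product.1 hq
    have h1 : ∑ p : Fin m × Fin n, (q.1 p.1 * q.2 p.2) ^ 2 = ‖q.1‖ ^ 2 * ‖q.2‖ ^ 2 := by
      rw [EuclideanSpace.norm_sq_eq, EuclideanSpace.norm_sq_eq, Finset.sum_mul_sum,
        Fintype.sum_prod_type]
      simp [mul_pow]
    have h2 : ‖q.1‖ ^ 2 * ‖q.2‖ ^ 2 ≤ 2 ^ 2 * 2 ^ 2 := by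
      gcongr
      · exact hU2 _ hu
      · exact hV2 _ hv
    -- 32 = 2 · 2² · 2²: a factor 2 for repeated entries and net points of norm at most 2.
    have h3 := stdPi_fiber_linear_form_ge_le φ hφ (fun p => q.1 p.1 * q.2 p.2) (C := 32)
      (r := √N * r) (by norm_num) (by rw [h1]; linarith) (by positivity)
    refine h3.trans (le_of_eq ?_)
    rw [mul_pow, Real.sq_sqrt hN.le]
    congr 2
    ring
  calc _ ≤ _ := measure_mono hsub
    _ ≤ ∑ q ∈ U ×ˢ V, stdPi κ {x | √N * r ≤ ∑ p, (q.1 p.1 * q.2 p.2) * x (φ p)} :=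
        measure_biUnion_finset_le _ _
    _ ≤ (U ×ˢ V).card • ENNReal.ofReal (Real.exp (-(N * r ^ 2 / 64))) :=
        Finset.sum_le_card_nsmul _ _ _ hterm
    _ ≤ _ := by
        rw [nsmul_eq_mul, ENNReal.ofReal_mul (by positivity)]
        gcongr
        rw [← ENNReal.ofReal_natCast, Finset.card_product]
        apply ENNReal.ofReal_le_ofReal
        push_cast
        gcongr
        · exact_mod_cast hUc
        · exact_mod_cast hVc

/-- Index pairs on and above the diagonal. -/
abbrev UpperPairs (h : ℕ) : Type := {p : Fin h × Fin h // p.1 ≤ p.2}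

/-- The position on or above the diagonal that determines the entry of a symmetric matrix. -/
def upperPair {h : ℕ} (p : Fin h × Fin h) : UpperPairs h :=
  if hp : p.1 ≤ p.2 then ⟨p, hp⟩ else ⟨p.swap, (not_le.1 hp).le⟩

theorem upperPair_eq {h : ℕ} (p : UpperPairs h) : upperPair p.1 = p := by
  simp [upperPair, p.2]

theorem card_fiber_upperPair_le {h : ℕ} (k : UpperPairs h) :
    (Finset.univ.filter fun p => upperPair p = k).card ≤ 2 := by
  refine (Finset.card_le_card (t := {k.1, k.1.swap}) fun p hp => ?_).trans Finset.card_le_two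
  have h1 := (Finset.mem_filter.1 hp).2
  rw [Finset.mem_insert, Finset.mem_singleton, ← h1]
  by_cases hp : p.1 ≤ p.2 <;> simp [upperPair, hp]

theorem card_fiber_id_le {κ : Type*} [Fintype κ] [DecidableEq κ] (k : κ) :
    (Finset.univ.filter fun p => id p = k).card ≤ 2 := by
  simp [Finset.filter_eq']

theorem sq_le_two_mul_card_upperPairs (h : ℕ) : h ^ 2 ≤ 2 * Fintype.card (UpperPairs h) := by
  have h1 := Finset.card_eq_sum_card_fiberwise (s := (Finset.univ : Finset (Fin h × Fin h)))
    (t := (Finset.univ : Finset (UpperPairs h))) (f := upperPair) (fun _ _ => by simp)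
  have h2 : ∑ k : UpperPairs h, (Finset.univ.filter fun p => upperPair p = k).card ≤
      Fintype.card (UpperPairs h) * 2 :=
    (Finset.sum_le_card_nsmul _ _ 2 fun k _ => card_fiber_upperPair_le k).trans (by simp)
  simp only [Finset.card_univ, Fintype.card_prod, Fintype.card_fin] at h1
  calc h ^ 2 = h * h := sq h
    _ ≤ _ := by rw [h1]; linarith

end GaussianMatrices

/-! ### Conditioning of the nets at initialization -/

section Initialization

theorem continuous_norm_actL (m n : ℕ) : Continuous fun A : Mat m n => ‖actL A‖ := by
  let L : Mat m n →ₗ[ℝ] (Vec n →L[ℝ] Vec m) :=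
    { toFun := actL, map_add' := actL_add, map_smul' := actL_smul }
  exact (L.continuous_of_finiteDimensional).norm

theorem continuous_frobSq (m n : ℕ) : Continuous fun A : Mat m n => frobSq A := by
  unfold frobSq frobInner
  fun_prop

theorem continuous_patternMat {m n : ℕ} {κ : Type*} (φ : Fin m × Fin n → κ) (N : ℝ) :
    Continuous (patternMat φ N) := by
  unfold patternMat
  refine continuous_matrix fun i j => ?_
  simp only [Matrix.of_apply]
  fun_prop

variable {h d : ℕ}

/-- Left multiplication by `W` on matrices, as an operator on the space of their entries. -/
noncomputable def leftMulL (W : Mat h h) (d : ℕ) :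
    EuclideanSpace ℝ (Fin h × Fin d) →L[ℝ] EuclideanSpace ℝ (Fin h × Fin d) :=
  LinearMap.toContinuousLinearMap
    { toFun := fun g => vec (W * Matrix.of fun i j => g (i, j))
      map_add' := fun f g => by
        rw [← vec_add, ← Matrix.mul_add]
        rfl
      map_smul' := fun c g => by
        rw [RingHom.id_apply, ← vec_smul, ← Matrix.mul_smul]
        rfl }

theorem leftMulL_apply (W : Mat h h) (g : EuclideanSpace ℝ (Fin h × Fin d)) :
    leftMulL W d g = vec (W * Matrix.of fun i j => g (i, j)) := rfl

theorem norm_leftMulL_le (W : Mat h h) (d : ℕ) : ‖leftMulL W d‖ ≤ ‖actL W‖ :=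
  ContinuousLinearMap.opNorm_le_bound _ (norm_nonneg _) fun g => by
    rw [leftMulL_apply]
    exact norm_vec_mul_le_left W _

theorem sum_normSq_leftMulL (W : Mat h h) (d : ℕ) :
    ∑ p, ‖leftMulL W d (EuclideanSpace.basisFun (Fin h × Fin d) ℝ p)‖ ^ 2 = d * frobSq W := by
  have h1 : ∀ p : Fin h × Fin d, ‖leftMulL W d (EuclideanSpace.basisFun (Fin h × Fin d) ℝ p)‖ ^ 2 =
      ∑ i, W i p.1 ^ 2 := by
    rintro ⟨k, l⟩
    have h2 : ∀ i j, (W * Matrix.of fun i j =>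
        (EuclideanSpace.basisFun (Fin h × Fin d) ℝ (k, l)) (i, j)) i j =
        if j = l then W i k else 0 := by
      intro i j
      by_cases hj : j = l <;> simp [Matrix.mul_apply, hj]
    rw [leftMulL_apply, norm_vec_sq]
    simp only [frobSq, frobInner, h2]
    simp [sq]
  simp_rw [h1, Fintype.sum_prod_type]
  simp only [Finset.sum_const, Finset.card_univ, Fintype.card_fin, nsmul_eq_mul]
  rw [← Finset.mul_sum, Finset.sum_comm]
  simp [frobSq, frobInner, sq]

/-- Concentration of `‖W Φ‖_F²` for fixed `W` and Gaussian `Φ`. -/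
theorem stdPi_frobSq_mul_lt_le (W : Mat h h) (hd : 0 < d) (hW : 0 < frobSq W) :
    stdPi (Fin h × Fin d) {x | frobSq (W * patternMat id (d : ℝ) x) < frobSq W / 2} ≤
      ENNReal.ofReal (4 * varSq * ‖actL W‖ ^ 2 / (d * frobSq W)) := by
  have hd' : (0 : ℝ) < d := by exact_mod_cast hd
  have h1 := stdGaussian_normSq_deviation_le (leftMulL W d)
    (EuclideanSpace.basisFun (Fin h × Fin d) ℝ) (ε := d * frobSq W / 2) (by positivity)
  rw [sum_normSq_leftMulL, ← map_pi_eq_stdGaussian, Measure.map_apply (by fun_prop)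
    (measurableSet_le measurable_const (by fun_prop))] at h1
  refine (measure_mono fun x hx => ?_).trans (h1.trans (ENNReal.ofReal_le_ofReal ?_))
  · simp only [mem_ofPred_eq, mem_preimage] at hx ⊢
    have h2 : W * patternMat id (d : ℝ) x = (√(d : ℝ))⁻¹ • (W * Matrix.of fun i j => x (i, j)) := by
      rw [← Matrix.mul_smul]; rfl
    have h3 : frobSq (W * patternMat id (d : ℝ) x) =
        (d : ℝ)⁻¹ * ‖leftMulL W d (WithLp.toLp 2 x)‖ ^ 2 := by
      rw [h2, ← norm_vec_sq, vec_smul, norm_smul, mul_pow, norm_inv, Real.norm_eq_abs, inv_pow,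
        sq_abs, Real.sq_sqrt hd'.le]
      rfl
    rw [h3, inv_mul_lt_iff₀ hd'] at hx
    rw [abs_sub_comm]
    refine le_trans ?_ (le_abs_self _)
    linarith
  · have h4 := norm_leftMulL_le W d
    have h5 := varSq_nonneg
    calc _ ≤ varSq * ‖actL W‖ ^ 2 * (d * frobSq W) / (d * frobSq W / 2) ^ 2 := by gcongr
      _ = _ := by field_simp; ring

/-- The entries on and above the diagonal already suffice: there are at least h²/2 of them, each of
variance 1/h, so their squares sum to at least h/2 in mean. Chebyshev allows losing half of it. -/
theorem stdPi_frobSq_proj_lt_le (hh : 0 < h) :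
    stdPi (UpperPairs h) {y | frobSq (patternMat upperPair (h : ℝ) y) < h / 4} ≤
      ENNReal.ofReal (8 * varSq / h ^ 2) := by
  have hh' : (0 : ℝ) < h := by exact_mod_cast hh
  have hc : (h : ℝ) ^ 2 ≤ 2 * Fintype.card (UpperPairs h) := by
    exact_mod_cast sq_le_two_mul_card_upperPairs h
  set c : ℝ := ((Fintype.card (UpperPairs h) : ℕ) : ℝ) with hcdef
  have hc0 : 0 < c := by have : 0 < (h : ℝ) ^ 2 := by positivity
                         linarith
  have h1 := pi_weighted_sum_sq_deviation_le (fun _ : UpperPairs h => (1 : ℝ)) (ε := c / 2)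
    (by positivity)
  simp only [one_mul, Finset.sum_const, Finset.card_univ, nsmul_eq_mul, mul_one, one_pow,
    ← hcdef] at h1
  refine (measure_mono fun y hy => ?_).trans (h1.trans (ENNReal.ofReal_le_ofReal ?_))
  · simp only [mem_ofPred_eq] at hy ⊢
    have h2 : (h : ℝ)⁻¹ * ∑ k, y k ^ 2 ≤ frobSq (patternMat upperPair (h : ℝ) y) := by
      have h3 : frobSq (patternMat upperPair (h : ℝ) y) =
          (h : ℝ)⁻¹ * ∑ p, y (upperPair p) ^ 2 := by
        have h4 : ((√(h : ℝ))⁻¹) ^ 2 = (h : ℝ)⁻¹ := by rw [inv_pow, Real.sq_sqrt hh'.le]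
        rw [← h4, Fintype.sum_prod_type, Finset.mul_sum]
        simp only [frobSq, frobInner, patternMat, Matrix.of_apply, Finset.mul_sum]
        exact Finset.sum_congr rfl fun i _ => Finset.sum_congr rfl fun j _ => by ring
      rw [h3]
      gcongr
      have h5 : ∑ k, y k ^ 2 = ∑ k : UpperPairs h, y (upperPair k.1) ^ 2 :=
        Finset.sum_congr rfl fun k _ => by rw [upperPair_eq]
      have h6 := Finset.sum_map Finset.univ (Function.Embedding.subtype fun p : Fin h × Fin h =>
        p.1 ≤ p.2) fun p => y (upperPair p) ^ 2
      rw [h5]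
      exact h6.symm.trans_le (Finset.sum_le_univ_sum_of_nonneg fun p => sq_nonneg _)
    have h6 := h2.trans_lt hy
    rw [inv_mul_lt_iff₀ hh'] at h6
    rw [abs_sub_comm]
    refine le_trans ?_ (le_abs_self _)
    nlinarith
  · have h5 := varSq_nonneg
    rw [div_le_div_iff₀ (by positivity) (by positivity)]
    nlinarith [mul_nonneg h5 hc0.le]

/-- The event that the nets at initialization have spectral norm at most `K` and a product with
squared Frobenius norm at least `h / 8`. -/
def WellConditioned (K : ℝ) (Φ₀ : Mat h d) (W₀ : Mat h h) : Prop :=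
  ‖actL Φ₀‖ ≤ K ∧ ‖actL W₀‖ ≤ K ∧ (h : ℝ) / 8 ≤ frobSq (W₀ * Φ₀)

/-- The last term comes from conditioning on W(0): when ‖W(0)‖ ≤ K and ‖W(0)‖_F² ≥ h/4, the mean of
‖W(0)Φ(0)‖_F² given W(0) is ‖W(0)‖_F², and half of it is at least h/8. -/
theorem prod_not_wellConditioned_le (hh : 0 < h) (hd : 0 < d) {K : ℝ} (hK : 0 ≤ K) :
    ((stdPi (Fin h × Fin d)).prod (stdPi (UpperPairs h)))
      {z | ¬ WellConditioned K (patternMat id (d : ℝ) z.1) (patternMat upperPair (h : ℝ) z.2)} ≤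
    ENNReal.ofReal (5 ^ h * 5 ^ d * Real.exp (-(d * K ^ 2 / 64))) +
      ENNReal.ofReal (5 ^ h * 5 ^ h * Real.exp (-(h * K ^ 2 / 64))) +
      ENNReal.ofReal (8 * varSq / h ^ 2) +
      ENNReal.ofReal (16 * varSq * K ^ 2 / (d * h)) := by
  have hh' : (0 : ℝ) < h := by exact_mod_cast hh
  have hd' : (0 : ℝ) < d := by exact_mod_cast hd
  let A : Set (Fin h × Fin d → ℝ) := {x | K < ‖actL (patternMat id (d : ℝ) x)‖}
  let B : Set (UpperPairs h → ℝ) := {y | K < ‖actL (patternMat upperPair (h : ℝ) y)‖}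
  let C : Set (UpperPairs h → ℝ) := {y | frobSq (patternMat upperPair (h : ℝ) y) < h / 4}
  let S : Set ((Fin h × Fin d → ℝ) × (UpperPairs h → ℝ)) :=
    {z | ‖actL (patternMat upperPair (h : ℝ) z.2)‖ ≤ K ∧
      (h : ℝ) / 4 ≤ frobSq (patternMat upperPair (h : ℝ) z.2) ∧
      frobSq (patternMat upperPair (h : ℝ) z.2 * patternMat id (d : ℝ) z.1) < h / 8}
  have hsub : {z : (Fin h × Fin d → ℝ) × (UpperPairs h → ℝ) |
      ¬ WellConditioned K (patternMat id (d : ℝ) z.1) (patternMat upperPair (h : ℝ) z.2)} ⊆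
      ((A ×ˢ univ ∪ univ ×ˢ B) ∪ univ ×ˢ C) ∪ S := by
    rintro ⟨x, y⟩ hz
    by_contra hcon
    simp only [mem_union, not_or, mem_prod, mem_univ, and_true, true_and, A, B, C, S,
      mem_ofPred_eq, not_lt, not_and] at hcon
    obtain ⟨⟨⟨h1, h2⟩, h3⟩, h4⟩ := hcon
    exact hz ⟨h1, h2, h4 h2 h3⟩
  have hpx := continuous_patternMat (id : Fin h × Fin d → Fin h × Fin d) (d : ℝ)
  have hpy := continuous_patternMat (upperPair : Fin h × Fin h → UpperPairs h) (h : ℝ)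
  have hS : MeasurableSet S := by
    have h1 : Continuous fun z : (Fin h × Fin d → ℝ) × (UpperPairs h → ℝ) =>
        ‖actL (patternMat upperPair (h : ℝ) z.2)‖ :=
      (continuous_norm_actL h h).comp (hpy.comp continuous_snd)
    have h2 : Continuous fun z : (Fin h × Fin d → ℝ) × (UpperPairs h → ℝ) =>
        frobSq (patternMat upperPair (h : ℝ) z.2) :=
      (continuous_frobSq h h).comp (hpy.comp continuous_snd)
    have h3 : Continuous fun z : (Fin h × Fin d → ℝ) × (UpperPairs h → ℝ) =>
        frobSq (patternMat upperPair (h : ℝ) z.2 * patternMat id (d : ℝ) z.1) :=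
      (continuous_frobSq h d).comp
        ((hpy.comp continuous_snd).matrix_mul (hpx.comp continuous_fst))
    exact (measurableSet_le h1.measurable measurable_const).inter
      ((measurableSet_le measurable_const h2.measurable).inter
        (measurableSet_lt h3.measurable measurable_const))
  have hSle : ((stdPi (Fin h × Fin d)).prod (stdPi (UpperPairs h))) S ≤
      ENNReal.ofReal (16 * varSq * K ^ 2 / (d * h)) := by
    rw [Measure.prod_apply_symm hS]
    calc _ ≤ ∫⁻ y : UpperPairs h → ℝ, ENNReal.ofReal (16 * varSq * K ^ 2 / (d * h))
          ∂(stdPi (UpperPairs h)) := by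
          refine lintegral_mono fun y => ?_
          set W := patternMat upperPair (h : ℝ) y with hW
          by_cases hy : ‖actL W‖ ≤ K ∧ (h : ℝ) / 4 ≤ frobSq W
          · have hW0 : 0 < frobSq W := lt_of_lt_of_le (by positivity) hy.2
            refine (measure_mono fun x hx => ?_).trans
              ((stdPi_frobSq_mul_lt_le W hd hW0).trans (ENNReal.ofReal_le_ofReal ?_))
            · have h1 := hx.2.2
              simp only [mem_ofPred_eq]
              simp only [← hW] at h1
              linarith [hy.2]
            · have := varSq_nonneg
              calc _ ≤ 4 * varSq * K ^ 2 / (d * (h / 4)) := by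
                    gcongr
                    · exact hy.1
                    · exact hy.2
                _ = _ := by field_simp; ring
          · have h1 : (fun x => (x, y)) ⁻¹' S = ∅ := by
              ext x
              simp only [mem_preimage, mem_empty_iff_false, iff_false]
              exact fun hx => hy ⟨hx.1, hx.2.1⟩
            rw [h1]
            simp
      _ = _ := by simp
  refine (measure_mono hsub).trans ((measure_union_le _ _).trans (add_le_add ?_ hSle))
  refine (measure_union_le _ _).trans (add_le_add ((measure_union_le _ _).trans
    (add_le_add ?_ ?_)) ?_)
  · rw [Measure.prod_prod, measure_univ, mul_one]
    exact stdPi_norm_patternMat_gt_le id card_fiber_id_le hd' hK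
  · rw [Measure.prod_prod, measure_univ, one_mul]
    exact stdPi_norm_patternMat_gt_le upperPair card_fiber_upperPair_le hh' hK
  · rw [Measure.prod_prod, measure_univ, one_mul]
    exact stdPi_frobSq_proj_lt_le hh

/-- Joint independence identifies the law of the rescaled free entries with a product of standard
Gaussians, and symmetry recovers W(0) below the diagonal. The transfer uses only
`Measure.le_map_apply`, so the event need not be measurable. -/
theorem IsGaussianInit.measure_not_wellConditioned_le {Ω : Type*} [MeasurableSpace Ω]
    {μ : Measure Ω} [IsProbabilityMeasure μ] {Φ₀ : Ω → Mat h d} {W₀ : Ω → Mat h h}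
    (hinit : IsGaussianInit μ Φ₀ W₀) (hh : 0 < h) (hd : 0 < d) {K : ℝ} (hK : 0 ≤ K) :
    μ {ω | ¬ WellConditioned K (Φ₀ ω) (W₀ ω)} ≤
    ENNReal.ofReal (5 ^ h * 5 ^ d * Real.exp (-(d * K ^ 2 / 64))) +
      ENNReal.ofReal (5 ^ h * 5 ^ h * Real.exp (-(h * K ^ 2 / 64))) +
      ENNReal.ofReal (8 * varSq / h ^ 2) +
      ENNReal.ofReal (16 * varSq * K ^ 2 / (d * h)) := by
  have hh' : (√(h : ℝ)) ≠ 0 := (Real.sqrt_pos.2 (by exact_mod_cast hh)).ne'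
  have hd' : (√(d : ℝ)) ≠ 0 := (Real.sqrt_pos.2 (by exact_mod_cast hd)).ne'
  let Z : ((Fin h × Fin d) ⊕ UpperPairs h) → Ω → ℝ := fun k ω =>
    Sum.elim (fun p => √(d : ℝ) * Φ₀ ω p.1 p.2) (fun p => √(h : ℝ) * W₀ ω p.1.1 p.1.2) k
  have hZlaw : ∀ k, HasLaw (Z k) (gaussianReal 0 1) μ := by
    rintro (p | p)
    · exact hinit.law_rep p.1 p.2
    · exact hinit.law_proj p.1.1 p.1.2
  have hZind : iIndepFun Z μ := by
    have h1 := hinit.indep.comp (fun k (x : ℝ) =>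
      Sum.elim (fun _ => √(d : ℝ)) (fun _ => √(h : ℝ)) k * x) fun k => by fun_prop
    convert h1 using 1
    ext k ω
    rcases k with p | p <;> rfl
  have hZm : AEMeasurable (fun ω k => Z k ω) μ := aemeasurable_pi_lambda _ fun k =>
    (hZlaw k).aemeasurable
  have hZmap : μ.map (fun ω k => Z k ω) =
      Measure.pi fun _ : (Fin h × Fin d) ⊕ UpperPairs h => gaussianReal 0 1 := by
    rw [(iIndepFun_iff_map_fun_eq_pi_map fun k => (hZlaw k).aemeasurable).1 hZind]
    congr 1
    ext1 k
    exact (hZlaw k).map_eq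
  have hmp := measurePreserving_sumPiEquivProdPi
    (fun _ : (Fin h × Fin d) ⊕ UpperPairs h => gaussianReal 0 1)
  refine le_trans ?_ (prod_not_wellConditioned_le hh hd hK)
  rw [← hmp.map_eq, ← hZmap]
  refine le_trans ?_ (Measure.le_map_apply hmp.measurable.aemeasurable _)
  refine le_trans ?_ (Measure.le_map_apply hZm _)
  refine measure_mono_ae ?_
  filter_upwards [hinit.symm] with ω hω hbad
  have h1 : patternMat id (d : ℝ) (fun p => Z (Sum.inl p) ω) = Φ₀ ω := by
    ext i j
    simp [patternMat, Z, hd']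
  have h2 : patternMat upperPair (h : ℝ) (fun p => Z (Sum.inr p) ω) = W₀ ω := by
    ext i j
    simp only [patternMat, Matrix.of_apply, Z, Sum.elim_inr]
    rw [inv_mul_cancel_left₀ hh']
    by_cases hij : i ≤ j
    · simp [upperPair, hij]
    · simp [upperPair, hij, hω.apply]
  change ¬ WellConditioned K (patternMat id (d : ℝ) (fun p => Z (Sum.inl p) ω))
    (patternMat upperPair (h : ℝ) (fun p => Z (Sum.inr p) ω))
  rw [h1, h2]
  exact hbad

end Initialization

/-! ### Concentration for fixed anchors -/

section Concentration

variable {h d : ℕ}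

theorem measurable_normDeviation {X : Type*} [MeasurableSpace X] (σ s : ℝ) (x₀ : Vec d)
    {A : X → Mat h d} (hA : ∀ i j, Measurable fun p => A p i j) {v : X → Vec d}
    (hv : Measurable v) : Measurable fun p => normDeviation σ s (A p) x₀ (v p) := by
  have hvj : ∀ j, Measurable fun p => v p j := fun j => by fun_prop
  unfold normDeviation
  simp only [act, EuclideanSpace.norm_sq_eq, Matrix.mulVec, dotProduct, Real.norm_eq_abs, sq_abs,
    frobSq, frobInner]
  fun_prop

theorem normDeviation_add_smul {σ s : ℝ} (hσ : 0 < σ) (hs : 0 < s) (A : Mat h d) (x₀ g : Vec d) :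
    normDeviation σ s A x₀ (x₀ + σ • g) =
      (‖act A g‖ ^ 2 - frobSq A) / s + 2 * ⟪act A.transpose (act A x₀), g⟫ / (s * σ) := by
  rw [normDeviation, act_add, act_smul, norm_add_sq_real, inner_smul_right, norm_smul, mul_pow,
    Real.norm_eq_abs, sq_abs, inner_act_transpose]
  field_simp
  ring

theorem augLaw_normDeviation_ge_le {σ s ε K : ℝ} (hσ : 0 < σ) (hs : 0 < s) (hε : 0 < ε)
    {A : Mat h d} (hA : ‖actL A‖ ≤ K) (x₀ : Vec d) :
    augLaw σ x₀ {x | ε ≤ |normDeviation σ s A x₀ x|} ≤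
      ENNReal.ofReal (K ^ 4 * (4 * varSq + 16 / σ ^ 2) / ε ^ 2 * ((d + ‖x₀‖ ^ 2) / s ^ 2)) := by
  have hv0 := varSq_nonneg
  have hK : 0 ≤ K := (norm_nonneg _).trans hA
  have hmeas : Measurable fun x => normDeviation σ s A x₀ x :=
    measurable_normDeviation σ s x₀ (A := fun _ : Vec d => A) (v := fun x => x)
      (fun _ _ => measurable_const) measurable_id'
  set v := act A.transpose (act A x₀) with hv
  have hvn : ‖v‖ ≤ K ^ 2 * ‖x₀‖ := by
    calc ‖v‖ ≤ ‖actL A.transpose‖ * ‖act A x₀‖ := (actL A.transpose).le_opNorm _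
      _ ≤ K * (K * ‖x₀‖) := by
        gcongr
        · exact (norm_actL_transpose_le A).trans hA
        · exact ((actL A).le_opNorm x₀).trans (by gcongr)
      _ = _ := by ring
  rw [augLaw_eq_map hσ, Measure.map_apply (by fun_prop)
    (measurableSet_le measurable_const hmeas.abs)]
  have hsub : (fun g => x₀ + σ • g) ⁻¹' {x | ε ≤ |normDeviation σ s A x₀ x|} ⊆
      {g | ε * s / 2 ≤ |‖actL A g‖ ^ 2 - frobSq A|} ∪
      {g | ε * s * σ / 4 ≤ |⟪v, g⟫|} := by
    intro g hg
    by_contra hcon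
    simp only [mem_union, mem_ofPred_eq, not_or, not_le, actL_apply] at hcon
    simp only [mem_preimage, mem_ofPred_eq, normDeviation_add_smul hσ hs, ← hv] at hg
    have h1 : |(‖act A g‖ ^ 2 - frobSq A) / s| < ε / 2 := by
      rw [abs_div, abs_of_pos hs, div_lt_iff₀ hs]
      linarith [hcon.1]
    have h2 : |2 * ⟪v, g⟫ / (s * σ)| < ε / 2 := by
      rw [abs_div, abs_of_pos (mul_pos hs hσ), div_lt_iff₀ (mul_pos hs hσ), abs_mul, abs_two]
      linarith [hcon.2]
    linarith [abs_add_le ((‖act A g‖ ^ 2 - frobSq A) / s) (2 * ⟪v, g⟫ / (s * σ))]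
  have h3 := stdGaussian_normSq_deviation_le (actL A) (EuclideanSpace.basisFun (Fin d) ℝ)
    (ε := ε * s / 2) (by positivity)
  rw [← frobSq_eq_sum_normSq] at h3
  have h4 := stdGaussian_abs_inner_ge_le v (ε := ε * s * σ / 4) (by positivity)
  refine (measure_mono hsub).trans ((measure_union_le _ _).trans ?_)
  rw [inputLaw]
  refine (add_le_add h3 h4).trans ?_
  have hF := frobSq_nonneg A
  rw [← ENNReal.ofReal_add (by positivity) (by positivity)]
  apply ENNReal.ofReal_le_ofReal
  calc _ ≤ varSq * K ^ 2 * (d * K ^ 2) / (ε * s / 2) ^ 2 +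
        (K ^ 2 * ‖x₀‖) ^ 2 / (ε * s * σ / 4) ^ 2 := by
        gcongr
        exact (frobSq_le A).trans (by gcongr)
    _ = K ^ 4 * (4 * varSq * d + 16 / σ ^ 2 * ‖x₀‖ ^ 2) / ε ^ 2 / s ^ 2 := by
        field_simp; ring
    _ ≤ K ^ 4 * ((4 * varSq + 16 / σ ^ 2) * (d + ‖x₀‖ ^ 2)) / ε ^ 2 / s ^ 2 := by
        gcongr
        have h3 : 0 ≤ 4 * varSq * ‖x₀‖ ^ 2 := by positivity
        have h4 : 0 ≤ 16 / σ ^ 2 * d := by positivity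
        nlinarith
    _ = _ := by field_simp

/-- Conditionally on the training randomness the fixed-matrix bound applies wherever ‖A‖ ≤ K. A
measurable version `a` of the entries makes Fubini applicable, and v stands for the projection onto
either view. -/
theorem sampleLaw_normDeviation_ge_le {Ω : Type*} [MeasurableSpace Ω] {μ : Measure Ω}
    [IsProbabilityMeasure μ] {σ s ε K : ℝ} (hσ : 0 < σ) (hs : 0 < s) (hε : 0 < ε)
    {A : Ω → Mat h d} (hAm : ∀ i j, AEMeasurable (fun ω => A ω i j) μ) (x₀ : Vec d)
    {v : Vec d × Vec d → Vec d}
    (hv : MeasurePreserving v ((augLaw σ x₀).prod (augLaw σ x₀)) (augLaw σ x₀)) :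
    sampleLaw μ σ x₀ {p | ε ≤ |normDeviation σ s (A p.1) x₀ (v p.2)|} ≤
      μ {ω | ¬ ‖actL (A ω)‖ ≤ K} +
      ENNReal.ofReal (K ^ 4 * (4 * varSq + 16 / σ ^ 2) / ε ^ 2 * ((d + ‖x₀‖ ^ 2) / s ^ 2)) := by
  have ha : AEMeasurable (fun ω (q : Fin h × Fin d) => A ω q.1 q.2) μ :=
    aemeasurable_pi_lambda _ fun q => hAm q.1 q.2
  obtain ⟨a, ham, haeq⟩ := ha
  let B : (Fin h × Fin d → ℝ) → Mat h d := fun y => Matrix.of fun i j => y (i, j)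
  have hB : Continuous B := continuous_matrix fun i j => by
    simp only [B, Matrix.of_apply]
    fun_prop
  have haA : ∀ᵐ ω ∂μ, B (a ω) = A ω := by
    filter_upwards [haeq] with ω hω
    ext i j
    exact (congrFun hω (i, j)).symm
  let S : Set (Ω × (Vec d × Vec d)) :=
    {p | ‖actL (B (a p.1))‖ ≤ K ∧ ε ≤ |normDeviation σ s (B (a p.1)) x₀ (v p.2)|}
  have hvm : Measurable v := hv.measurable
  have hS : MeasurableSet S := by
    have h1 : Measurable fun p : Ω × (Vec d × Vec d) => ‖actL (B (a p.1))‖ :=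
      ((continuous_norm_actL h d).comp hB).measurable.comp
        (ham.comp measurable_fst)
    have h2 : Measurable fun p : Ω × (Vec d × Vec d) => v p.2 := hvm.comp measurable_snd
    have h3 : Measurable fun p : Ω × (Vec d × Vec d) =>
        normDeviation σ s (B (a p.1)) x₀ (v p.2) :=
      measurable_normDeviation σ s x₀ (fun i j => by
        simp only [B, Matrix.of_apply]
        fun_prop) h2
    exact (measurableSet_le h1 measurable_const).inter (measurableSet_le measurable_const h3.abs)
  have hsub : {p : Ω × (Vec d × Vec d) | ε ≤ |normDeviation σ s (A p.1) x₀ (v p.2)|} ⊆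
      ({ω | ¬ ‖actL (A ω)‖ ≤ K} ∪ {ω | ¬ B (a ω) = A ω}) ×ˢ univ ∪ S := by
    rintro ⟨ω, y⟩ hp
    by_contra hcon
    simp only [mem_union, mem_prod, mem_univ, and_true, mem_ofPred_eq, not_or, not_not, S,
      not_and] at hcon
    obtain ⟨⟨h1, h2⟩, h3⟩ := hcon
    rw [h2] at h3
    exact h3 h1 hp
  rw [sampleLaw]
  refine (measure_mono hsub).trans ((measure_union_le _ _).trans (add_le_add ?_ ?_))
  · rw [Measure.prod_prod, measure_univ, mul_one]
    refine (measure_union_le _ _).trans ?_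
    rw [ae_iff.1 haA, add_zero]
  · rw [Measure.prod_apply hS]
    refine (lintegral_mono fun ω => ?_).trans (by rw [lintegral_const, measure_univ, mul_one])
    by_cases hω : ‖actL (B (a ω))‖ ≤ K
    · have h1 : Prod.mk ω ⁻¹' S ⊆ v ⁻¹' {x | ε ≤ |normDeviation σ s (B (a ω)) x₀ x|} :=
        fun y hy => hy.2
      refine (measure_mono h1).trans ((Measure.le_map_apply hv.measurable.aemeasurable _).trans ?_)
      rw [hv.map_eq]
      exact augLaw_normDeviation_ge_le hσ hs hε hω x₀
    · have h1 : Prod.mk ω ⁻¹' S = ∅ := by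
        ext y
        simp only [mem_preimage, mem_empty_iff_false, iff_false]
        exact fun hy => hω hy.1
      rw [h1]
      simp

theorem inputLaw_normSq_ge_le {r : ℝ} (hr : 0 < r) :
    inputLaw d {x | r ≤ d + ‖x‖ ^ 2} ≤ ENNReal.ofReal (2 * d / r) := by
  have h1 : ∫⁻ x, ENNReal.ofReal (d + ‖x‖ ^ 2) ∂(inputLaw d) = ENNReal.ofReal (2 * d) := by
    have h2 := lintegral_normSq_stdGaussian (ContinuousLinearMap.id ℝ (Vec d))
      (EuclideanSpace.basisFun (Fin d) ℝ)
    simp only [ContinuousLinearMap.id_apply, OrthonormalBasis.norm_eq_one, one_pow,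
      Finset.sum_const, Finset.card_univ, Fintype.card_fin, nsmul_eq_mul, mul_one] at h2
    have h3 : ∀ x : Vec d, ENNReal.ofReal (d + ‖x‖ ^ 2) =
        ENNReal.ofReal d + ENNReal.ofReal (‖x‖ ^ 2) := fun x =>
      ENNReal.ofReal_add (by positivity) (by positivity)
    simp_rw [h3]
    rw [lintegral_add_left measurable_const, lintegral_const, measure_univ, mul_one, inputLaw, h2,
      ← ENNReal.ofReal_add (by positivity) (by positivity)]
    congr 1
    ring
  have h4 := meas_ge_le_lintegral_div (μ := inputLaw d)
    (f := fun x => ENNReal.ofReal (d + ‖x‖ ^ 2)) (by fun_prop) (ε := ENNReal.ofReal r)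
    (by simpa using hr) ENNReal.ofReal_ne_top
  rw [h1, ← ENNReal.ofReal_div_of_pos hr] at h4
  exact (measure_mono fun x hx => ENNReal.ofReal_le_ofReal hx).trans h4

/-- Nets whose spectral norm is bounded in probability concentrate for fixed anchors. -/
theorem littleOPFixedAnchor_normDeviation {σ K : ℝ} (hσ : 0 < σ)
    {d h : ℕ → ℕ} {Ω : ℕ → Type*} [∀ n, MeasurableSpace (Ω n)]
    (μ : ∀ n, Measure (Ω n)) [∀ n, IsProbabilityMeasure (μ n)]
    {s : ℕ → ℝ} (hs : ∀ᶠ n in atTop, 0 < s n)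
    (hds : Tendsto (fun n => (d n : ℝ) / s n ^ 2) atTop (𝓝 0))
    (A : ∀ n, Ω n → Mat (h n) (d n)) (hAm : ∀ n i j, AEMeasurable (fun ω => A n ω i j) (μ n))
    (hA : Tendsto (fun n => μ n {ω | ¬ ‖actL (A n ω)‖ ≤ K}) atTop (𝓝 0))
    (v : ∀ n, Vec (d n) × Vec (d n) → Vec (d n))
    (hv : ∀ n x₀, MeasurePreserving (v n) ((augLaw σ x₀).prod (augLaw σ x₀)) (augLaw σ x₀)) :
    LittleOPFixedAnchor μ σ (fun n x₀ p => normDeviation σ (s n) (A n p.1) x₀ (v n p.2)) := by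
  have hv0 := varSq_nonneg
  refine ⟨fun ε hε δ hδ => ?_, fun x₀ hx₀ ε hε => ?_⟩
  · set C := K ^ 4 * (4 * varSq + 16 / σ ^ 2) / ε ^ 2 with hC
    have hC0 : 0 ≤ C := by
      have : 0 ≤ K ^ 4 := by positivity
      positivity
    have hlim : Tendsto (fun n => ENNReal.ofReal (4 * (C + 1) / δ * ((d n : ℝ) / s n ^ 2)))
        atTop (𝓝 0) := by
      have := ENNReal.tendsto_ofReal (hds.const_mul (4 * (C + 1) / δ))
      simpa using this
    refine tendsto_of_tendsto_of_tendsto_of_le_of_le' tendsto_const_nhds hlim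
      (Eventually.of_forall fun _ => bot_le) ?_
    have hev : ∀ᶠ n in atTop, μ n {ω | ¬ ‖actL (A n ω)‖ ≤ K} < ENNReal.ofReal (δ / 2) :=
      hA.eventually (gt_mem_nhds (by simpa using hδ))
    filter_upwards [hev, hs] with n hn hsn
    -- Half of δ covers the matrices of large norm. Only anchors with d + ‖x₀‖² of order s² can use
    -- up the other half, and Markov makes these rare; C + 1 avoids dividing by zero.
    have hsub : {x₀ : Vec (d n) | δ ≤ |(sampleLaw (μ n) σ x₀).real
        {p | ε ≤ |normDeviation σ (s n) (A n p.1) x₀ (v n p.2)|}|} ⊆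
        {x₀ | δ * s n ^ 2 / (2 * (C + 1)) ≤ d n + ‖x₀‖ ^ 2} := by
      intro x₀ hx
      simp only [mem_ofPred_eq] at hx ⊢
      by_contra! hcon
      refine absurd hx (not_le.2 ?_)
      rw [abs_of_nonneg measureReal_nonneg]
      have h1 := sampleLaw_normDeviation_ge_le (K := K) hσ hsn hε (hAm n) x₀ (hv n x₀)
      have h2 : C * ((d n + ‖x₀‖ ^ 2) / s n ^ 2) ≤ δ / 2 := by
        rw [lt_div_iff₀ (by positivity)] at hcon
        rw [← mul_div_assoc, div_le_iff₀ (by positivity)]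
        have : 0 ≤ d n + ‖x₀‖ ^ 2 := by positivity
        nlinarith
      have h3 : sampleLaw (μ n) σ x₀ {p | ε ≤ |normDeviation σ (s n) (A n p.1) x₀ (v n p.2)|} <
          ENNReal.ofReal δ := by
        calc _ ≤ _ := h1
          _ ≤ μ n {ω | ¬ ‖actL (A n ω)‖ ≤ K} + ENNReal.ofReal (δ / 2) := by
              gcongr
          _ < ENNReal.ofReal (δ / 2) + ENNReal.ofReal (δ / 2) :=
              ENNReal.add_lt_add_right ENNReal.ofReal_ne_top hn
          _ = _ := by
              rw [← ENNReal.ofReal_add (by positivity) (by positivity)]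
              congr 1
              ring
      exact (ENNReal.toReal_lt_of_lt_ofReal h3)
    refine (measure_mono hsub).trans ((inputLaw_normSq_ge_le (by positivity)).trans (le_of_eq ?_))
    congr 1
    field_simp
    ring
  · obtain ⟨L, hL⟩ := hx₀
    set C := K ^ 4 * (4 * varSq + 16 / σ ^ 2) / ε ^ 2 with hC
    have hC0 : 0 ≤ C := by
      have : 0 ≤ K ^ 4 := by positivity
      positivity
    have hlim : Tendsto (fun n => μ n {ω | ¬ ‖actL (A n ω)‖ ≤ K} +
        ENNReal.ofReal (C * (1 + L) * ((d n : ℝ) / s n ^ 2))) atTop (𝓝 0) := by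
      have := hA.add (ENNReal.tendsto_ofReal (hds.const_mul (C * (1 + L))))
      simpa using this
    refine tendsto_of_tendsto_of_tendsto_of_le_of_le' tendsto_const_nhds hlim
      (Eventually.of_forall fun _ => bot_le) ?_
    filter_upwards [hs] with n hsn
    refine (sampleLaw_normDeviation_ge_le (K := K) hσ hsn hε (hAm n) (x₀ n) (hv n _)).trans ?_
    refine add_le_add le_rfl (ENNReal.ofReal_le_ofReal ?_)
    rw [← hC, mul_assoc]
    gcongr
    rw [← mul_div_assoc]
    gcongr
    linarith [hL n]

end Concentration

/-! ### The proportional limit -/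

section Asymptotics

theorem five_pow_le_exp (n : ℕ) : (5 : ℝ) ^ n ≤ Real.exp (2 * n) := by
  have h1 : (5 : ℝ) ≤ Real.exp 2 := by
    have := Real.exp_one_gt_d9
    rw [show (2 : ℝ) = 1 + 1 by norm_num, Real.exp_add]
    nlinarith
  calc (5 : ℝ) ^ n ≤ Real.exp 2 ^ n := by gcongr
    _ = _ := by rw [← Real.exp_nat_mul]; congr 1; ring

/-- In the proportional regime the Gaussian initialization is well conditioned with probability
tending to one. -/
theorem tendsto_measure_not_wellConditioned {α K : ℝ} (hα : 0 < α)
    (hK : 64 * (5 + 4 / α) ≤ K ^ 2) (hK0 : 0 ≤ K)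
    {d h : ℕ → ℕ} (hd : Tendsto d atTop atTop) (hh : Tendsto h atTop atTop)
    (hdh : Tendsto (fun n => (d n : ℝ) / (h n : ℝ)) atTop (𝓝 α))
    {Ω : ℕ → Type*} [∀ n, MeasurableSpace (Ω n)]
    (μ : ∀ n, Measure (Ω n)) [∀ n, IsProbabilityMeasure (μ n)]
    (Φ₀ : ∀ n, Ω n → Mat (h n) (d n)) (W₀ : ∀ n, Ω n → Mat (h n) (h n))
    (hinit : ∀ n, IsGaussianInit (μ n) (Φ₀ n) (W₀ n)) :
    Tendsto (fun n => μ n {ω | ¬ WellConditioned K (Φ₀ n ω) (W₀ n ω)}) atTop (𝓝 0) := by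
  have hdr : Tendsto (fun n => (d n : ℝ)) atTop atTop := tendsto_natCast_atTop_atTop.comp hd
  have hhr : Tendsto (fun n => (h n : ℝ)) atTop atTop := tendsto_natCast_atTop_atTop.comp hh
  have h1 : Tendsto (fun n => Real.exp (-(d n : ℝ))) atTop (𝓝 0) :=
    Real.tendsto_exp_neg_atTop_nhds_zero.comp hdr
  have h2 : Tendsto (fun n => Real.exp (-(h n : ℝ))) atTop (𝓝 0) :=
    Real.tendsto_exp_neg_atTop_nhds_zero.comp hhr
  have h3 : Tendsto (fun n => 8 * varSq / (h n : ℝ) ^ 2) atTop (𝓝 0) :=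
    ((tendsto_pow_atTop two_ne_zero).comp hhr).const_div_atTop _
  have h4 : Tendsto (fun n => 16 * varSq * K ^ 2 / ((d n : ℝ) * h n)) atTop (𝓝 0) :=
    (hdr.atTop_mul_atTop₀ hhr).const_div_atTop _
  have hlim := (((ENNReal.tendsto_ofReal h1).add (ENNReal.tendsto_ofReal h2)).add
    (ENNReal.tendsto_ofReal h3)).add (ENNReal.tendsto_ofReal h4)
  simp only [ENNReal.ofReal_zero, add_zero] at hlim
  refine tendsto_of_tendsto_of_tendsto_of_le_of_le' tendsto_const_nhds hlim
    (Eventually.of_forall fun _ => bot_le) ?_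
  filter_upwards [hd.eventually_gt_atTop 0, hh.eventually_gt_atTop 0,
    hdh.eventually_const_lt (half_lt_self hα)] with n hdn hhn hdhn
  have hhn' : (0 : ℝ) < h n := by exact_mod_cast hhn
  refine ((hinit n).measure_not_wellConditioned_le hhn hdn hK0).trans ?_
  gcongr ENNReal.ofReal ?_ + ENNReal.ofReal ?_ + _ + _
  · rw [lt_div_iff₀ hhn'] at hdhn
    calc _ ≤ Real.exp (2 * h n) * Real.exp (2 * d n) * Real.exp (-(d n * K ^ 2 / 64)) := by
          gcongr <;> exact five_pow_le_exp _
      _ = Real.exp (2 * h n + 2 * d n - d n * K ^ 2 / 64) := by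
          rw [← Real.exp_add, ← Real.exp_add]; congr 1
      _ ≤ _ := by
          apply Real.exp_le_exp.2
          -- Eventually d/h > α/2, so the entropy 2h + 2d of the nets is at most (2 + 4/α)d, below
          -- dK²/64 with room for the decay exp(-d).
          have h5 : (h n : ℝ) ≤ 2 / α * d n := by
            rw [div_mul_eq_mul_div, le_div_iff₀ hα]; linarith
          have h6 : (d n : ℝ) * (64 * (5 + 4 / α)) ≤ d n * K ^ 2 := by gcongr
          have h7 : (d n : ℝ) * (64 * (5 + 4 / α)) = 64 * (5 * d n + 2 * (2 / α * d n)) := by ring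
          have h8 : (0 : ℝ) ≤ d n := Nat.cast_nonneg _
          linarith
  · calc _ ≤ Real.exp (2 * h n) * Real.exp (2 * h n) * Real.exp (-(h n * K ^ 2 / 64)) := by
          gcongr <;> exact five_pow_le_exp _
      _ = Real.exp (4 * h n - h n * K ^ 2 / 64) := by
          rw [← Real.exp_add, ← Real.exp_add]; congr 1; ring
      _ ≤ _ := by
          apply Real.exp_le_exp.2
          have h6 : (h n : ℝ) * (64 * (5 + 4 / α)) ≤ h n * K ^ 2 := by gcongr
          have h7 : 0 ≤ (h n : ℝ) * (64 * (4 / α)) := by positivity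
          linarith

/-- In the proportional regime the spectral norms of the nets stay bounded along the gradient flow,
with probability tending to one. -/
theorem exists_tendsto_measure_norm_actL {σ ρ α T : ℝ} (hσ : 0 < σ) (hρ : 0 < ρ) (hα : 0 < α)
    {d h : ℕ → ℕ} (hd : Tendsto d atTop atTop) (hh : Tendsto h atTop atTop)
    (hdh : Tendsto (fun n => (d n : ℝ) / (h n : ℝ)) atTop (𝓝 α))
    {Ω : ℕ → Type*} [∀ n, MeasurableSpace (Ω n)]
    (μ : ∀ n, Measure (Ω n)) [∀ n, IsProbabilityMeasure (μ n)]
    (Φ : ∀ n, Ω n → ℝ → Mat (h n) (d n)) (W : ∀ n, Ω n → ℝ → Mat (h n) (h n))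
    (hinit : ∀ n, IsGaussianInit (μ n) (fun ω => Φ n ω 0) (fun ω => W n ω 0))
    (hflow : Tendsto (fun n => μ n {ω | ¬ IsSymmetricGradientFlow σ ρ T (Φ n ω) (W n ω)})
      atTop (𝓝 0)) :
    ∃ K : ℝ, ∀ t ∈ Icc 0 T,
      Tendsto (fun n => μ n {ω | ¬ (‖actL (Φ n ω t)‖ ≤ K ∧ ‖actL (W n ω t)‖ ≤ K)})
        atTop (𝓝 0) := by
  -- The term 4/α pays for the row net of Φ(0) in terms of d; the 5 covers the entropy 4h for W(0)
  -- and leaves exp(-h).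
  set K : ℝ := √(64 * (5 + 4 / α)) with hKdef
  have hK2 : K ^ 2 = 64 * (5 + 4 / α) := Real.sq_sqrt (by positivity)
  have hK0 : 0 ≤ K := Real.sqrt_nonneg _
  have hK1 : 1 ≤ K := by
    have : 0 < 4 / α := by positivity
    nlinarith
  refine ⟨K + 1, fun t ht => ?_⟩
  have hwc := tendsto_measure_not_wellConditioned hα hK2.ge hK0 hd hh hdh μ _ _ hinit
  have hlim := hflow.add hwc
  rw [add_zero] at hlim
  refine tendsto_of_tendsto_of_tendsto_of_le_of_le' tendsto_const_nhds hlim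
    (Eventually.of_forall fun _ => bot_le) ?_
  have hhr : Tendsto (fun n => (h n : ℝ) / 8) atTop atTop :=
    (tendsto_natCast_atTop_atTop.comp hh).atTop_div_const (by norm_num)
  filter_upwards [hhr.eventually_ge_atTop ((4 * (K + 1) ^ 2) ^ 2),
    hhr.eventually_gt_atTop
      (64 * (1 + σ ^ 2) / σ ^ 2 * (K + 1) ^ 2 * Real.exp (ρ * T) ^ 4 * T ^ 2)] with n hn1 hn2
  refine (measure_mono fun ω hω => ?_).trans (measure_union_le _ _)
  by_contra hcon
  simp only [mem_union, mem_ofPred_eq, not_or, not_not] at hcon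
  obtain ⟨hf, hΦ₀, hW₀, hP⟩ := hcon
  -- With p² = h/8 tending to infinity, both lower bounds on p, which depend only on σ, ρ, T and K,
  -- hold eventually.
  refine hω (hf.norm_actL_le hσ hρ hK1 hΦ₀ hW₀ (p := √((h n : ℝ) / 8)) ?_ ?_ ?_ ht)
  · refine Real.sqrt_le_iff.2 ⟨norm_nonneg _, ?_⟩
    rw [norm_vec_sq]
    exact hP
  · exact Real.le_sqrt_of_sq_le hn1
  · rw [Real.sq_sqrt (by positivity)]
    exact hn2

end Asymptotics

end SimSiam

theorem mainTheorem4
    (σ ρ α T : ℝ) (hσ : 0 < σ) (hρ : 0 < ρ) (hα : 0 < α)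
    (d h : ℕ → ℕ) (hd : Tendsto d atTop atTop) (hh : Tendsto h atTop atTop)
    (hdh : Tendsto (fun n => (d n : ℝ) / (h n : ℝ)) atTop (𝓝 α))
    (Ω : ℕ → Type*) [∀ n, MeasurableSpace (Ω n)]
    (μ : ∀ n, Measure (Ω n)) [∀ n, IsProbabilityMeasure (μ n)]
    (Φ : ∀ n, Ω n → ℝ → SimSiam.Mat (h n) (d n))
    (W : ∀ n, Ω n → ℝ → SimSiam.Mat (h n) (h n))
    (hΦmeas : ∀ n, ∀ t ∈ Icc 0 T, ∀ i j, AEMeasurable (fun ω => Φ n ω t i j) (μ n))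
    (hWmeas : ∀ n, ∀ t ∈ Icc 0 T, ∀ i j, AEMeasurable (fun ω => W n ω t i j) (μ n))
    (hinit : ∀ n, SimSiam.IsGaussianInit (μ n) (fun ω => Φ n ω 0) (fun ω => W n ω 0))
    (hflow : Tendsto
      (fun n => μ n {ω | ¬ SimSiam.IsSymmetricGradientFlow σ ρ T (Φ n ω) (W n ω)})
      atTop (𝓝 0)) :
    ∀ t ∈ Icc 0 T,
      SimSiam.LittleOPFixedAnchor μ σ (fun n x₀ p =>
        SimSiam.normDeviation σ (h n : ℝ) (Φ n p.1 t) x₀ p.2.1) ∧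
      SimSiam.LittleOPFixedAnchor μ σ (fun n x₀ p =>
        SimSiam.normDeviation σ (h n : ℝ) (Φ n p.1 t) x₀ p.2.2) ∧
      SimSiam.LittleOPFixedAnchor μ σ (fun n x₀ p =>
        SimSiam.normDeviation σ ((h n : ℝ) ^ 2) (W n p.1 t * Φ n p.1 t) x₀ p.2.1) ∧
      SimSiam.LittleOPFixedAnchor μ σ (fun n x₀ p =>
        SimSiam.normDeviation σ ((h n : ℝ) ^ 2) (W n p.1 t * Φ n p.1 t) x₀ p.2.2) := by
  intro t ht
  obtain ⟨K, hK⟩ := SimSiam.exists_tendsto_measure_norm_actL hσ hρ hα hd hh hdh μ Φ W hinit hflow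
  have hKt := hK t ht
  have hhr : Tendsto (fun n => (h n : ℝ)) atTop atTop := tendsto_natCast_atTop_atTop.comp hh
  have hs1 : ∀ᶠ n in atTop, (0 : ℝ) < h n := hhr.eventually_gt_atTop 0
  have hs2 : ∀ᶠ n in atTop, (0 : ℝ) < (h n : ℝ) ^ 2 := hs1.mono fun n hn => by positivity
  -- Here d/h² = (d/h)/h tends to zero; for Ψ the scale h² leaves even more room.
  have hd1 : Tendsto (fun n => (d n : ℝ) / (h n : ℝ) ^ 2) atTop (𝓝 0) := by
    refine (hdh.div_atTop hhr).congr fun n => ?_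
    rw [div_div, sq]
  have hd2 : Tendsto (fun n => (d n : ℝ) / ((h n : ℝ) ^ 2) ^ 2) atTop (𝓝 0) := by
    refine (hd1.div_atTop ((tendsto_pow_atTop two_ne_zero).comp hhr)).congr fun n => ?_
    rw [div_div, sq ((h n : ℝ) ^ 2)]
    rfl
  have hΦ : Tendsto (fun n => μ n {ω | ¬ ‖SimSiam.actL (Φ n ω t)‖ ≤ K}) atTop (𝓝 0) :=
    tendsto_of_tendsto_of_tendsto_of_le_of_le tendsto_const_nhds hKt (fun _ => bot_le)
      fun n => measure_mono fun ω hω hcon => hω hcon.1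
  have hΨ : Tendsto (fun n => μ n {ω | ¬ ‖SimSiam.actL (W n ω t * Φ n ω t)‖ ≤ K * K})
      atTop (𝓝 0) :=
    tendsto_of_tendsto_of_tendsto_of_le_of_le tendsto_const_nhds hKt (fun _ => bot_le)
      fun n => measure_mono fun ω hω hcon => hω <|
        (SimSiam.norm_actL_mul_le _ _).trans <|
          mul_le_mul hcon.2 hcon.1 (norm_nonneg _) ((norm_nonneg _).trans hcon.2)
  have hΨmeas : ∀ n i j, AEMeasurable (fun ω => (W n ω t * Φ n ω t) i j) (μ n) := by
    intro n i j
    simp only [Matrix.mul_apply]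
    exact Finset.aemeasurable_fun_sum _ fun k _ => (hWmeas n t ht i k).mul (hΦmeas n t ht k j)
  exact ⟨SimSiam.littleOPFixedAnchor_normDeviation hσ μ hs1 hd1 (fun n ω => Φ n ω t)
      (fun n => hΦmeas n t ht) hΦ (fun _ => Prod.fst) fun _ _ => measurePreserving_fst,
    SimSiam.littleOPFixedAnchor_normDeviation hσ μ hs1 hd1 (fun n ω => Φ n ω t)
      (fun n => hΦmeas n t ht) hΦ (fun _ => Prod.snd) fun _ _ => measurePreserving_snd,
    SimSiam.littleOPFixedAnchor_normDeviation hσ μ hs2 hd2 (fun n ω => W n ω t * Φ n ω t)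
      hΨmeas hΨ (fun _ => Prod.fst) fun _ _ => measurePreserving_fst,
    SimSiam.littleOPFixedAnchor_normDeviation hσ μ hs2 hd2 (fun n ω => W n ω t * Φ n ω t)
      hΨmeas hΨ (fun _ => Prod.snd) fun _ _ => measurePreserving_snd⟩
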